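/- **Setting.** Let $m_1,m_2,K,r\ge 1$ be integers with $K\le m_1+m_2$, and let $M=UV^T$ be an $m_1\times m_2$ real matrix of rank $r$, where $U\in\mathbb{R}^{m_1\times K}$, $V\in\mathbb{R}^{m_2\times K}$ and $|U_{i,k}|\le C$, $|V_{j,k}|\le C$ for all $i,j,k$. Let $P$ be the law of a pair $(X,Y)$ where $X$ is uniform on $\{1,\dots,m_1\}\times\{1,\dots,m_2\}$ and $Y=M_X+\varepsilon$ with $\mathbb{E}[Y^2]<\infty$ and $\mathbb{E}[\varepsilon\mid X]=0$. Put $R(\theta)=\mathbb{E}[(Y-\theta_X)^2]$ and let $\overline R$ be the minimum of $R$ over $\{\mu\nu^T:\mu\in\mathbb{R}^{m_1\times K},\nu\in\mathbb{R}^{m_2\times K}\}$. Let $\pi$ be the following prior on pairs $(\mu,\nu)\in\mathbb{R}^{m_1\times K}\times\mathbb{R}^{m_2\times K}$: $\gamma_1,\dots,\gamma_K$ are i.i.d. inverse gamma with shape $a$ and scale $b$ (the law of $1/G$ with $G$ gamma of shape $a$ and rate $b$) and, given $\gamma$, the columns $\mu_{\cdot,k}$ and $\nu_{\cdot,k}$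 are independent with laws $\mathcal{N}(0,\gamma_k I_{m_1})$ and $\mathcal{N}(0,\gamma_k I_{m_2})$. For $\beta>0$ let $\pi_\beta(\mathrm{d}(\mu,\nu))\propto \exp[-\beta R(\mu\nu^T)]\,\pi(\mathrm{d}(\mu,\nu))$. Let $\mathcal{M}$ be the set of all probability measures on the pairs $(\mu,\nu)$ and $\mathcal{F}\subset\mathcal{M}$ the mean-field family of all product measures $\prod_{i}u_i(\mathrm{d}\mu_{i,\cdot})\prod_{j}v_j(\mathrm{d}\nu_{j,\cdot})$ over the rows. $\mathcal{K}(\rho,\pi)$ denotes the Kullback–Leibler divergence, $\int\log\frac{\mathrm{d}\rho}{\mathrm{d}\pi}\,\mathrm{d}\rho$ if $\rho\ll\pi$ and $+\infty$ otherwise, and $\log^+x=\max(0,\log x)$. **Theorem.** For all $a>0$ and $C>0$ there is a constant $\mathcal{C}=\mathcal{C}(a,C)>0$, depending on $a$ and $C$ only, such that in the setting above, for every $\beta>0$ and every $b$ with $$0<b\le\frac{1}{2\beta\,(m_1\vee m_2)\log\big(2K(m_1\vee m_2)\big)},$$ one has $$\inf_{\rho\in\mathcal{F}}\mathcal{K}(\rho,\pi_\beta)\;\le\;\mathcal{C}\,\Delta_\beta,\qquad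 \Delta_\beta:= r(m_1+m_2)\log^+\!\Big[\frac{\beta(m_1+m_2)K}{b}\Big]+\frac1\beta .$$ Hence the PAC-Bayes bounds restricted to the variational family $\mathcal{F}$ inherit any rate that holds for those of the Gibbs posterior (where the infimum is over $\mathcal{M}$), up to this term. Precisely, for $\varepsilon\in(0,1)$, with the same constant $\mathcal{C}$: (i) if $\lambda=2\beta$, $f\ge0$ and $\mathcal{B}(\mathcal{A})=\inf_{\rho\in\mathcal{A}}\big\{\int R\,\mathrm{d}\rho+\tfrac{2}{\lambda}[f+\mathcal{K}(\rho,\pi)+\log\tfrac2\varepsilon]\big\}$, then $\mathcal{B}(\mathcal{F})\le\mathcal{B}(\mathcal{M})+\frac{2}{\lambda}\,\mathcal{C}\,\Delta_\beta$; (ii) if $\lambda+g=2\beta$, $\lambda-g>0$ and $\overline{\mathcal{B}}(\mathcal{A})=\frac{1}{\lambda-g}\inf_{\rho\in\mathcal{A}}\big\{(\lambda+g)\int(R-\overline R)\,\mathrm{d}\rho+2\mathcal{K}(\rho,\pi)+2\log\tfrac2\varepsilon\big\}$, then $\overline{\mathcal{B}}(\mathcal{F})\le\overline{\mathcal{B}}(\mathcal{M})+\frac{2}{\lambda-g}\,\mathcal{C}\,\Delta_\beta$.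 In (i) and (ii), $\int R\,\mathrm{d}\rho$ and $\int (R-\overline R)\,\mathrm{d}\rho$ mean the integrals of $R(\mu\nu^T)$ and $R(\mu\nu^T)-\overline R\ge 0$ against $\rho(\mathrm{d}(\mu,\nu))$. -/

import Mathlib

open MeasureTheory ProbabilityTheory InformationTheory
open scoped ENNReal

namespace MatrixCompletion

/-- A pair `(U, V)` of factors, stored by rows: `U i` is the `i`-th row of the `m₁ × K` matrix `U`
and `V j` the `j`-th row of the `m₂ × K` matrix `V`. -/
abbrev Factors (m₁ m₂ K : ℕ) : Type := (Fin m₁ → Fin K → ℝ) × (Fin m₂ → Fin K → ℝ)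

/-- The matrix `θ = U Vᵀ`. -/
def Factors.toMatrix {m₁ m₂ K : ℕ} (p : Factors m₁ m₂ K) : Matrix (Fin m₁) (Fin m₂) ℝ :=
  Matrix.of p.1 * (Matrix.of p.2).transpose

/-- `P` is the law of a pair `(X, Y)` in which `X` is uniform on the entries of an `m₁ × m₂` matrix
and `Y = M_X + ε`, with noise `ε` that has a finite second moment and is centred given `X`. -/
structure IsObservationLaw {m₁ m₂ : ℕ} (M : Matrix (Fin m₁) (Fin m₂) ℝ)
    (P : Measure ((Fin m₁ × Fin m₂) × ℝ)) : Prop where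
  prob : IsProbabilityMeasure P
  uniform : ∀ x : Fin m₁ × Fin m₂, P (Prod.fst ⁻¹' {x}) = ((m₁ : ℝ≥0∞) * (m₂ : ℝ≥0∞))⁻¹
  sq_integrable : Integrable (fun z : (Fin m₁ × Fin m₂) × ℝ => z.2 ^ 2) P
  centred : ∀ x : Fin m₁ × Fin m₂, ∫ z in Prod.fst ⁻¹' {x}, (z.2 - M x.1 x.2) ∂P = 0

/-- The quadratic risk `R(θ) = 𝔼[(Y - θ_X)²]`. -/
noncomputable def risk {m₁ m₂ : ℕ} (P : Measure ((Fin m₁ × Fin m₂) × ℝ))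
    (θ : Matrix (Fin m₁) (Fin m₂) ℝ) : ℝ :=
  ∫ z, (z.2 - θ z.1.1 z.1.2) ^ 2 ∂P

/-- The smallest risk over the parameter set `{U Vᵀ}`. -/
noncomputable def minRisk {m₁ m₂ : ℕ} (P : Measure ((Fin m₁ × Fin m₂) × ℝ)) (K : ℕ) : ℝ :=
  ⨅ p : Factors m₁ m₂ K, risk P p.toMatrix

/-- The inverse gamma distribution with shape `a` and scale `b`: the law of `1 / G`, where `G` has
the gamma distribution with shape `a` and rate `b`. -/
noncomputable def invGammaMeasure (a b : ℝ) : Measure ℝ :=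
  (gammaMeasure a b).map (fun x => x⁻¹)

/-- The law of `(U, V)` given the variances `γ`: all entries are independent, and those of the
`k`-th columns of `U` and `V` have the distribution `N(0, γ k)`. -/
noncomputable def gaussianFactors (m₁ m₂ K : ℕ) (γ : Fin K → ℝ) : Measure (Factors m₁ m₂ K) :=
  (Measure.pi fun _ : Fin m₁ => Measure.pi fun k : Fin K => gaussianReal 0 (γ k).toNNReal).prod
    (Measure.pi fun _ : Fin m₂ => Measure.pi fun k : Fin K => gaussianReal 0 (γ k).toNNReal)

theorem gaussianFactors_eq_map (m₁ m₂ K : ℕ) (γ : Fin K → ℝ) :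
    gaussianFactors m₁ m₂ K γ = (gaussianFactors m₁ m₂ K fun _ => 1).map
      (fun p => (fun i k => √(γ k) * p.1 i k, fun j k => √(γ k) * p.2 j k)) := by
  have key : ∀ m : ℕ, (Measure.pi fun _ : Fin m => Measure.pi fun k : Fin K =>
      gaussianReal 0 (γ k).toNNReal) =
      (Measure.pi fun _ : Fin m => Measure.pi fun k : Fin K =>
        gaussianReal 0 (1 : ℝ).toNNReal).map (fun q i k => √(γ k) * q i k) := by
    intro m
    have h1 : ∀ k, gaussianReal 0 (γ k).toNNReal =
        (gaussianReal 0 (1 : ℝ).toNNReal).map (fun x => √(γ k) * x) := by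
      intro k
      rw [gaussianReal_map_const_mul, mul_zero]
      congr 1
      ext
      rcases le_total 0 (γ k) with h | h
      · simp [Real.sq_sqrt h, h]
      · simp [Real.sqrt_eq_zero_of_nonpos h, h]
    have h2 : (Measure.pi fun k : Fin K => gaussianReal 0 (γ k).toNNReal) =
        (Measure.pi fun _ : Fin K => gaussianReal 0 (1 : ℝ).toNNReal).map
          (fun q k => √(γ k) * q k) := by
      have h3 : ∀ k, AEMeasurable (fun x : ℝ => √(γ k) * x) (gaussianReal 0 (1 : ℝ).toNNReal) :=
        fun k => by fun_prop
      have hp : ∀ k, IsProbabilityMeasure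
          ((gaussianReal 0 (1 : ℝ).toNNReal).map fun x : ℝ => √(γ k) * x) :=
        fun k => Measure.isProbabilityMeasure_map (h3 k)
      rw [Measure.pi_map_pi h3]
      simp_rw [← h1]
    rw [Measure.pi_map_pi (f := fun _ (q : Fin K → ℝ) k => √(γ k) * q k)
      (fun i => (measurable_pi_lambda _ fun k => by fun_prop).aemeasurable)]
    simp_rw [← h2]
  unfold gaussianFactors
  rw [key m₁, key m₂, Measure.map_prod_map _ _ (by fun_prop) (by fun_prop)]
  rfl

/-- The Gaussian laws depend measurably on the variances, so that the mixture `prior` is genuine. -/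
theorem measurable_gaussianFactors (m₁ m₂ K : ℕ) : Measurable (gaussianFactors m₁ m₂ K) := by
  have : SFinite (gaussianFactors m₁ m₂ K fun _ => 1) := by
    unfold gaussianFactors; infer_instance
  refine Measure.measurable_of_measurable_coe _ fun s hs => ?_
  have hF : Measurable (fun z : (Fin K → ℝ) × Factors m₁ m₂ K =>
      ((fun i k => √(z.1 k) * z.2.1 i k, fun j k => √(z.1 k) * z.2.2 j k) :
        Factors m₁ m₂ K)) := by fun_prop
  have hm := measurable_measure_prodMk_left (ν := gaussianFactors m₁ m₂ K fun _ => 1) (hF hs)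
  convert! hm using 1
  ext γ
  rw [gaussianFactors_eq_map, Measure.map_apply (by fun_prop) hs]
  rfl

/-- The prior `π` on `(U, V)`: the variances are i.i.d. inverse gamma, and given them `(U, V)` has
the law `gaussianFactors`. -/
noncomputable def prior (m₁ m₂ K : ℕ) (a b : ℝ) : Measure (Factors m₁ m₂ K) :=
  (Measure.pi fun _ : Fin K => invGammaMeasure a b).bind (gaussianFactors m₁ m₂ K)

/-- `π_β(dθ) ∝ exp(-β R(θ)) π(dθ)`. -/
noncomputable def gibbs {m₁ m₂ K : ℕ} (P : Measure ((Fin m₁ × Fin m₂) × ℝ))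
    (π : Measure (Factors m₁ m₂ K)) (β : ℝ) : Measure (Factors m₁ m₂ K) :=
  π.tilted fun p => -β * risk P p.toMatrix

/-- All probability measures on the parameter space. -/
def allLaws (m₁ m₂ K : ℕ) : Set (Measure (Factors m₁ m₂ K)) :=
  {ρ | IsProbabilityMeasure ρ}

/-- The mean-field family: the rows of `U` and of `V` are independent, with arbitrary laws. -/
def meanField (m₁ m₂ K : ℕ) : Set (Measure (Factors m₁ m₂ K)) :=
  {ρ | ∃ (u : Fin m₁ → Measure (Fin K → ℝ)) (v : Fin m₂ → Measure (Fin K → ℝ)),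
    (∀ i, IsProbabilityMeasure (u i)) ∧ (∀ j, IsProbabilityMeasure (v j)) ∧
      ρ = (Measure.pi u).prod (Measure.pi v)}

/-- The slow-rate (Hoeffding type) PAC-Bayes bound
`inf_{ρ ∈ A} { ∫ R dρ + 2 (f + 𝒦(ρ, π) + log (2 / ε)) / lam }`. -/
noncomputable def slowBound {m₁ m₂ K : ℕ} (P : Measure ((Fin m₁ × Fin m₂) × ℝ))
    (π : Measure (Factors m₁ m₂ K)) (lam f ε : ℝ) (A : Set (Measure (Factors m₁ m₂ K))) : ℝ≥0∞ :=
  ⨅ ρ ∈ A, ((∫⁻ p, ENNReal.ofReal (risk P p.toMatrix) ∂ρ) +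
    2 * (ENNReal.ofReal f + klDiv ρ π + ENNReal.ofReal (Real.log (2 / ε))) / ENNReal.ofReal lam)

/-- The fast-rate (Bernstein type) PAC-Bayes bound
`inf_{ρ ∈ A} { (lam + g) ∫ (R - R̄) dρ + 2 𝒦(ρ, π) + 2 log (2 / ε) } / (lam - g)`. -/
noncomputable def fastBound {m₁ m₂ K : ℕ} (P : Measure ((Fin m₁ × Fin m₂) × ℝ))
    (π : Measure (Factors m₁ m₂ K)) (lam g ε : ℝ) (A : Set (Measure (Factors m₁ m₂ K))) : ℝ≥0∞ :=
  (⨅ ρ ∈ A, (ENNReal.ofReal (lam + g) *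
      (∫⁻ p, ENNReal.ofReal (risk P p.toMatrix - minRisk P K) ∂ρ) +
    2 * klDiv ρ π + 2 * ENNReal.ofReal (Real.log (2 / ε)))) / ENNReal.ofReal (lam - g)

/-- The complexity term `r (m₁ + m₂) log⁺(β (m₁ + m₂) K / b) + 1 / β`. -/
noncomputable def complexity (m₁ m₂ K r : ℕ) (b β : ℝ) : ℝ :=
  r * ((m₁ : ℝ) + m₂) * Real.posLog (β * ((m₁ : ℝ) + m₂) * K / b) + 1 / β

end MatrixCompletion

namespace MatrixCompletion

/-! It suffices to exhibit one good mean-field law `ρ`: a product of Gaussians centred at factors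
`q`, with variance `s` on the first `r` columns and `b` on the null ones. No divergence is computed
exactly. If `exp (-F) ρ ≤ π`, then `𝒦(ρ, π) ≤ ∫ F dρ` (`klDiv_le_of_withDensity_le`), and such a
domination survives restriction of a mixture. The prior is a mixture over the variances `γ`; keeping
only `γ k` in a window `[T k, (1 + 1/n) T k]`, with `n = m₁ + m₂`, gives an explicit `F`
(`withDensity_le_prior`). A null column has `s = T = b` and centre `0`, so each of its entries costs
at most `1 / (2n)`. The null columns therefore contribute order `K log n` in total, instead of `n K`
times a logarithm.

As `M` minimises the risk, `exp (-β (R - R(M))) π ≤ π_β`, hence `𝒦(ρ, π_β) ≤ β ∫ (R - R(M)) dρ + ∫ F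
dρ`. The same right side controls both PAC-Bayes bounds, since over all laws they cannot go below
their value with risk `R(M)` and zero divergence.

The given factors need not have only `r` nonzero columns, so `M` is refactored through an
orthonormal basis of its column space (`exists_padded_rank_factorization`). The new entries are
polynomially large, which is harmless because their size enters through a logarithm. With `A = β n K
/ b`, the cost `K log n` is absorbed in two regimes. If `β K ≥ 1`, then `n` is at most a multiple of
`A`. If `β K ≤ 1`, the law is centred at zero: the risk of ignoring `M` is of order `1 / β`, and a
separate argument treats `K log n`. -/

/-! ### Kullback–Leibler divergence from a domination of measures. -/

/-- If `exp (-F) ρ ≤ π` for probability measures, then `𝒦(ρ, π) ≤ ∫ F dρ`. -/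
theorem klDiv_le_of_withDensity_le {α : Type*} [MeasurableSpace α] {ρ π : Measure α}
    [IsProbabilityMeasure ρ] [IsProbabilityMeasure π] {F : α → ℝ} (hFm : Measurable F)
    (hF : Integrable F ρ)
    (h : ρ.withDensity (fun x => ENNReal.ofReal (Real.exp (-F x))) ≤ π) :
    klDiv ρ π ≤ ENNReal.ofReal (∫ x, F x ∂ρ) := by
  have hem : Measurable fun x => ENNReal.ofReal (Real.exp (-F x)) := by fun_prop
  have hac : ρ ≪ π := by
    refine (withDensity_absolutelyContinuous' hem.aemeasurable ?_).trans
      (Measure.absolutelyContinuous_of_le h)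
    exact Filter.Eventually.of_forall fun x => by simp [Real.exp_pos]
  have hle : llr ρ π ≤ᵐ[ρ] F := by
    have h1 := hac.ae_le (Measure.rnDeriv_le_one_of_le h)
    have h2 := hac.ae_le (Measure.rnDeriv_withDensity_left (μ := ρ) (ν := π)
      hem.aemeasurable (by simp))
    filter_upwards [h1, h2, Measure.rnDeriv_pos hac, hac.ae_le (Measure.rnDeriv_lt_top ρ π)]
      with x h1 h2 h3 h4
    rw [h2] at h1
    have h5 : 0 < (ρ.rnDeriv π x).toReal := ENNReal.toReal_pos h3.ne' h4.ne
    rw [← ENNReal.ofReal_toReal h4.ne, ← ENNReal.ofReal_mul (Real.exp_pos _).le,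
      Pi.one_apply, ENNReal.ofReal_le_one] at h1
    rw [llr, Real.log_le_iff_le_exp h5]
    have h6 : Real.exp (F x) * Real.exp (-F x) = 1 := by rw [← Real.exp_add]; simp
    nlinarith [Real.exp_pos (F x)]
  -- `log x ≥ 1 - 1 / x`, where `1 / x` is the integrable derivative `dπ/dρ`. This lower bound makes
  -- `llr` integrable, without which `klDiv` would be infinite by convention.
  have hge : (fun x => 1 - (π.rnDeriv ρ x).toReal) ≤ᵐ[ρ] llr ρ π := by
    filter_upwards [neg_llr hac, Measure.rnDeriv_pos hac,
      hac.ae_le (Measure.rnDeriv_lt_top ρ π), Measure.inv_rnDeriv hac] with x h1 h2 h3 h4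
    have h5 : 0 < (ρ.rnDeriv π x).toReal := ENNReal.toReal_pos h2.ne' h3.ne
    have h6 := Real.one_sub_inv_le_log_of_pos h5
    rw [← h4, Pi.inv_apply, ENNReal.toReal_inv]
    exact h6
  have hint : Integrable (llr ρ π) ρ :=
    integrable_of_le_of_le (measurable_llr ρ π).aestronglyMeasurable hge hle
      ((integrable_const _).sub Measure.integrable_toReal_rnDeriv) hF
  rw [klDiv_of_ac_of_integrable hac hint]
  refine ENNReal.ofReal_le_ofReal ?_
  simpa using integral_mono_ae hint hF hle

/-! ### Densities of product measures and of Gaussian laws. -/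

/-- Boxes determine a product measure, and on a box the indicator times the density is a product of
functions of independent coordinates, so its integral factors. -/
theorem pi_withDensity {ι : Type*} [Fintype ι] {X : ι → Type*} [∀ i, MeasurableSpace (X i)]
    (μ : ∀ i, Measure (X i)) [∀ i, IsProbabilityMeasure (μ i)] (f : ∀ i, X i → ℝ≥0∞)
    (hf : ∀ i, Measurable (f i)) [∀ i, SigmaFinite ((μ i).withDensity (f i))] :
    Measure.pi (fun i => (μ i).withDensity (f i)) =
      (Measure.pi μ).withDensity fun x => ∏ i, f i (x i) := by
  symm
  refine (Measure.pi_eq fun s hs => ?_).symm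
  rw [withDensity_apply _ (MeasurableSet.univ_pi hs), ← lintegral_indicator (.univ_pi hs)]
  have h1 : ∀ x, (Set.univ.pi s).indicator (fun x => ∏ i, f i (x i)) x =
      ∏ i, (s i).indicator (f i) (x i) := by
    intro x
    by_cases hx : x ∈ Set.univ.pi s
    · rw [Set.indicator_of_mem hx]
      exact Finset.prod_congr rfl fun i _ => (Set.indicator_of_mem (hx i trivial) _).symm
    · rw [Set.indicator_of_notMem hx]
      simp only [Set.mem_pi, Set.mem_univ, true_implies, not_forall] at hx
      obtain ⟨i, hi⟩ := hx
      exact (Finset.prod_eq_zero (Finset.mem_univ i) (Set.indicator_of_notMem hi _)).symm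
  simp_rw [h1]
  refine (lintegral_prod_eq_prod_lintegral_of_indepFun Finset.univ
    (fun i (x : ∀ i, X i) => (s i).indicator (f i) (x i))
    (iIndepFun_pi fun i => ((hf i).indicator (hs i)).aemeasurable)
    (fun i => ((hf i).indicator (hs i)).comp (measurable_pi_apply i))).trans ?_
  refine Finset.prod_congr rfl fun i _ => ?_
  rw [withDensity_apply _ (hs i), ← lintegral_indicator (hs i)]
  exact (measurePreserving_eval μ i).lintegral_comp ((hf i).indicator (hs i))

theorem pi_withDensity_exp {ι : Type*} [Fintype ι] {X : ι → Type*} [∀ i, MeasurableSpace (X i)]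
    (μ : ∀ i, Measure (X i)) [∀ i, IsProbabilityMeasure (μ i)] (G : ∀ i, X i → ℝ)
    (hG : ∀ i, Measurable (G i)) :
    Measure.pi (fun i => (μ i).withDensity fun x => ENNReal.ofReal (Real.exp (-G i x))) =
      (Measure.pi μ).withDensity fun x => ENNReal.ofReal (Real.exp (-∑ i, G i (x i))) := by
  have : ∀ i, SigmaFinite ((μ i).withDensity fun x => ENNReal.ofReal (Real.exp (-G i x))) :=
    fun i => SigmaFinite.withDensity_ofReal _
  rw [pi_withDensity μ _ fun i => by have := hG i; fun_prop]
  congr 1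
  ext x
  rw [← ENNReal.ofReal_prod_of_nonneg fun i _ => (Real.exp_pos _).le, ← Real.exp_sum,
    Finset.sum_neg_distrib]

/-- A centred Gaussian law has density `exp (-G)` with respect to any other Gaussian law. -/
theorem gaussianReal_eq_withDensity (u : ℝ) {s γ : ℝ} (hs : 0 < s) (hγ : 0 < γ) :
    gaussianReal 0 γ.toNNReal = (gaussianReal u s.toNNReal).withDensity fun x =>
      ENNReal.ofReal (Real.exp
        (-(Real.log (γ / s) / 2 + x ^ 2 / (2 * γ) - (x - u) ^ 2 / (2 * s)))) := by
  have hs' : s.toNNReal ≠ 0 := by simpa using hs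
  have hγ' : γ.toNNReal ≠ 0 := by simpa using hγ
  rw [gaussianReal_of_var_ne_zero _ hs', gaussianReal_of_var_ne_zero _ hγ',
    ← withDensity_mul _ (measurable_gaussianPDF _ _) (by fun_prop)]
  congr 1
  ext x
  rw [Pi.mul_apply, gaussianPDF, gaussianPDF, ← ENNReal.ofReal_mul (gaussianPDFReal_nonneg _ _ _)]
  congr 1
  rw [gaussianPDFReal, gaussianPDFReal, Real.coe_toNNReal _ hs.le, Real.coe_toNNReal _ hγ.le]
  have h1 : (√(2 * Real.pi * γ))⁻¹ = (√(2 * Real.pi * s))⁻¹ * Real.exp (-(Real.log (γ / s) / 2)) := by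
    rw [Real.exp_neg, ← Real.log_sqrt (by positivity), Real.exp_log (by positivity), ← mul_inv,
      ← Real.sqrt_mul (by positivity)]
    congr 2
    field_simp
  rw [h1, mul_assoc (_⁻¹), mul_assoc (_⁻¹), ← Real.exp_add, ← Real.exp_add]
  congr 2
  ring

/-- The exponent comparing `N(0, γ)`, uniformly over `γ ∈ [T, (1 + η) T]`, with `N(u, s)`. -/
noncomputable def gaussianCost (u s T η x : ℝ) : ℝ :=
  Real.log ((1 + η) * T / s) / 2 + x ^ 2 / (2 * T) - (x - u) ^ 2 / (2 * s)

@[fun_prop]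
theorem measurable_gaussianCost (u s T η : ℝ) : Measurable (gaussianCost u s T η) := by
  unfold gaussianCost; fun_prop

/-- The logarithm is largest at the upper end of the window and `x ^ 2 / γ` at the lower end, so one
exponent serves every `γ` in it. -/
theorem le_gaussianCost {u s T η γ : ℝ} (hs : 0 < s) (hT : 0 < T) (h1 : T ≤ γ)
    (h2 : γ ≤ (1 + η) * T) (x : ℝ) :
    Real.log (γ / s) / 2 + x ^ 2 / (2 * γ) - (x - u) ^ 2 / (2 * s) ≤ gaussianCost u s T η x := by
  have hγ : 0 < γ := hT.trans_le h1
  unfold gaussianCost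
  gcongr

theorem integrable_sub_sq_gaussianReal (c u s : ℝ) :
    Integrable (fun x => (x - c) ^ 2) (gaussianReal u s.toNNReal) := by
  have h : MemLp (fun x : ℝ => x - c) 2 (gaussianReal u s.toNNReal) :=
    (memLp_id_gaussianReal' 2 (by simp)).sub (memLp_const c)
  exact h.integrable_sq

theorem integral_sub_sq_gaussianReal (c u : ℝ) {s : ℝ} (hs : 0 < s) :
    ∫ x, (x - c) ^ 2 ∂gaussianReal u s.toNNReal = s + (u - c) ^ 2 := by
  have h1 : ∫ x, (x - u) ^ 2 ∂gaussianReal u s.toNNReal = s := by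
    have := variance_fun_id_gaussianReal (μ := u) (v := s.toNNReal)
    rw [variance_eq_integral (by fun_prop), integral_id_gaussianReal, Real.coe_toNNReal _ hs.le]
      at this
    exact this
  have hid : Integrable (fun x : ℝ => x) (gaussianReal u s.toNNReal) :=
    (memLp_id_gaussianReal 1).integrable (by simp)
  have h2 : ∀ x : ℝ, (x - c) ^ 2 = (x - u) ^ 2 + (2 * (u - c) * x + (c ^ 2 - u ^ 2)) := by
    intro x; ring
  simp_rw [h2]
  have h3 : Integrable (fun x => 2 * (u - c) * x + (c ^ 2 - u ^ 2)) (gaussianReal u s.toNNReal) :=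
    (hid.const_mul _).add (integrable_const _)
  rw [integral_add (integrable_sub_sq_gaussianReal _ _ _) h3, h1,
    integral_add (hid.const_mul _) (integrable_const _), integral_const_mul,
    integral_id_gaussianReal]
  simp

theorem integrable_gaussianCost (u s T η : ℝ) :
    Integrable (gaussianCost u s T η) (gaussianReal u s.toNNReal) := by
  have h := ((integrable_const (Real.log ((1 + η) * T / s) / 2)).add
    ((integrable_sub_sq_gaussianReal 0 u s).div_const (2 * T))).sub
    ((integrable_sub_sq_gaussianReal u u s).div_const (2 * s))
  refine h.congr (Filter.Eventually.of_forall fun x => ?_)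
  simp [gaussianCost]

/-- For `u = 0` and `s = T` everything cancels except `log (1 + η) / 2`: this is what makes null
columns cheap. -/
theorem integral_gaussianCost (u T η : ℝ) {s : ℝ} (hs : 0 < s) :
    ∫ x, gaussianCost u s T η x ∂gaussianReal u s.toNNReal =
      Real.log ((1 + η) * T / s) / 2 + (s + u ^ 2) / (2 * T) - 1 / 2 := by
  have h : ∀ x, gaussianCost u s T η x = Real.log ((1 + η) * T / s) / 2 + (x - 0) ^ 2 / (2 * T) -
    (x - u) ^ 2 / (2 * s) := by intro x; simp [gaussianCost]
  simp_rw [h]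
  have h3 : Integrable (fun x => Real.log ((1 + η) * T / s) / 2 + (x - 0) ^ 2 / (2 * T))
      (gaussianReal u s.toNNReal) :=
    (integrable_const _).add ((integrable_sub_sq_gaussianReal 0 u s).div_const (2 * T))
  rw [integral_sub h3 ((integrable_sub_sq_gaussianReal u u s).div_const (2 * s)),
    integral_add (integrable_const _) ((integrable_sub_sq_gaussianReal 0 u s).div_const (2 * T)),
    integral_div _ (fun x => (x - 0) ^ 2), integral_div _ (fun x => (x - u) ^ 2),
    integral_sub_sq_gaussianReal _ _ hs, integral_sub_sq_gaussianReal _ _ hs]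
  simp
  field_simp

/-! ### Mass of a window under the inverse gamma law. -/

/-- The inverse gamma law charges `[t, (1 + η) t]` polynomially. -/
theorem le_invGammaMeasure_Icc {a b t η : ℝ} (ha : 0 < a) (hb : 0 < b) (hbt : b ≤ t) (hη : 0 < η)
    (hη1 : η ≤ 1) :
    ENNReal.ofReal ((2 : ℝ) ^ (-a - 1) * Real.exp (-1) / Real.Gamma a * (b / t) ^ a * η) ≤
      invGammaMeasure a b (Set.Icc t ((1 + η) * t)) := by
  have ht : 0 < t := hb.trans_le hbt
  have hΓ := Real.Gamma_pos_of_pos ha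
  set I := Set.Icc ((1 + η) * t)⁻¹ t⁻¹
  have hsub : I ⊆ (fun x : ℝ => x⁻¹) ⁻¹' Set.Icc t ((1 + η) * t) := by
    rintro x ⟨h1, h2⟩
    have hx : 0 < x := lt_of_lt_of_le (by positivity) h1
    exact ⟨(le_inv_comm₀ ht hx).2 h2, (inv_le_comm₀ hx (by positivity)).2 h1⟩
  -- On the inverted window `x` lies between `1 / (2t)` and `1 / t`, so `b * x ≤ 1` and the
  -- exponential factor is at least `exp (-1)`. The power `x ^ (a - 1)` is monotone in a direction
  -- that depends on whether `a ≥ 1`.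
  have hlow : ∀ x ∈ I, ENNReal.ofReal (b ^ a / Real.Gamma a * ((2 : ℝ) ^ (-a) * t⁻¹ ^ (a - 1)) *
      Real.exp (-1)) ≤ gammaPDF a b x := by
    rintro x ⟨h1, h2⟩
    have hx : 0 < x := lt_of_lt_of_le (by positivity) h1
    rw [gammaPDF_of_nonneg hx.le]
    have h3 : (2 : ℝ) ^ (-a) * t⁻¹ ^ (a - 1) ≤ x ^ (a - 1) := by
      have hx2 : (2 : ℝ)⁻¹ * t⁻¹ ≤ x := by
        refine le_trans ?_ h1
        rw [← mul_inv]
        gcongr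
        linarith
      rcases le_total 1 a with h | h
      · calc (2 : ℝ) ^ (-a) * t⁻¹ ^ (a - 1) ≤ (2 : ℝ) ^ (-(a - 1)) * t⁻¹ ^ (a - 1) := by
              gcongr <;> linarith
          _ = ((2 : ℝ)⁻¹ * t⁻¹) ^ (a - 1) := by
              rw [Real.mul_rpow (by positivity) (by positivity), Real.inv_rpow zero_le_two,
                Real.rpow_neg zero_le_two]
          _ ≤ x ^ (a - 1) := Real.rpow_le_rpow (by positivity) hx2 (by linarith)
      · calc (2 : ℝ) ^ (-a) * t⁻¹ ^ (a - 1) ≤ 1 * t⁻¹ ^ (a - 1) := by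
              gcongr
              exact Real.rpow_le_one_of_one_le_of_nonpos (by norm_num) (by linarith)
          _ ≤ x ^ (a - 1) := by
              rw [one_mul]
              exact Real.rpow_le_rpow_of_nonpos hx h2 (by linarith)
    have h4 : b * x ≤ 1 := by
      calc b * x ≤ t * t⁻¹ := by gcongr
        _ = 1 := mul_inv_cancel₀ ht.ne'
    gcongr
  rw [invGammaMeasure, Measure.map_apply measurable_inv measurableSet_Icc]
  refine le_trans ?_ (measure_mono hsub)
  rw [gammaMeasure, withDensity_apply _ measurableSet_Icc]
  refine le_trans ?_ (setLIntegral_mono' measurableSet_Icc hlow)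
  rw [setLIntegral_const, Real.volume_Icc, ← ENNReal.ofReal_mul (by positivity)]
  refine ENNReal.ofReal_le_ofReal ?_
  have h5 : t⁻¹ - ((1 + η) * t)⁻¹ = η / (1 + η) * t⁻¹ := by field_simp; ring
  have h6 : η / 2 ≤ η / (1 + η) := by gcongr; linarith
  have h7 : t⁻¹ ^ (a - 1) * t⁻¹ = t⁻¹ ^ a := by
    rw [Real.rpow_sub_one (by positivity)]; field_simp
  rw [h5]
  calc (2 : ℝ) ^ (-a - 1) * Real.exp (-1) / Real.Gamma a * (b / t) ^ a * η
      = b ^ a / Real.Gamma a * ((2 : ℝ) ^ (-a) * (t⁻¹ ^ (a - 1) * t⁻¹)) * Real.exp (-1) * (η / 2) := by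
        rw [h7, Real.rpow_sub_one (by norm_num), div_eq_mul_inv b t,
          Real.mul_rpow hb.le (by positivity)]
        ring
    _ ≤ b ^ a / Real.Gamma a * ((2 : ℝ) ^ (-a) * (t⁻¹ ^ (a - 1) * t⁻¹)) * Real.exp (-1) *
        (η / (1 + η)) := by gcongr
    _ = _ := by ring

/-! ### Gaussian matrix laws dominated by the prior. -/

/-- The law of an `m × K` matrix with independent entries, the `(i, k)`-th being `N(u i k, s k)`. -/
noncomputable def gaussianRows {m K : ℕ} (u : Fin m → Fin K → ℝ) (s : Fin K → ℝ) :
    Measure (Fin m → Fin K → ℝ) :=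
  Measure.pi fun i => Measure.pi fun k => gaussianReal (u i k) (s k).toNNReal

instance {m K : ℕ} (u : Fin m → Fin K → ℝ) (s : Fin K → ℝ) :
    IsProbabilityMeasure (gaussianRows u s) := by
  unfold gaussianRows; infer_instance

/-- The law of two independent matrices distributed according to `gaussianRows`. -/
noncomputable def gaussianLaw {m₁ m₂ K : ℕ} (q : Factors m₁ m₂ K) (s : Fin K → ℝ) :
    Measure (Factors m₁ m₂ K) :=
  (gaussianRows q.1 s).prod (gaussianRows q.2 s)

instance {m₁ m₂ K : ℕ} (q : Factors m₁ m₂ K) (s : Fin K → ℝ) :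
    IsProbabilityMeasure (gaussianLaw q s) := by
  unfold gaussianLaw; infer_instance

theorem gaussianLaw_mem_meanField {m₁ m₂ K : ℕ} (q : Factors m₁ m₂ K) (s : Fin K → ℝ) :
    gaussianLaw q s ∈ meanField m₁ m₂ K :=
  ⟨_, _, fun _ => inferInstance, fun _ => inferInstance, rfl⟩

/-- The sum of the entrywise costs of a matrix. -/
noncomputable def rowsCost {m K : ℕ} (u : Fin m → Fin K → ℝ) (s T : Fin K → ℝ) (η : ℝ)
    (x : Fin m → Fin K → ℝ) : ℝ :=
  ∑ i, ∑ k, gaussianCost (u i k) (s k) (T k) η (x i k)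

@[fun_prop]
theorem measurable_rowsCost {m K : ℕ} (u : Fin m → Fin K → ℝ) (s T : Fin K → ℝ) (η : ℝ) :
    Measurable (rowsCost u s T η) := by
  unfold rowsCost; fun_prop

theorem integrable_comp_entry {m K : ℕ} (u : Fin m → Fin K → ℝ) (s : Fin K → ℝ) (i : Fin m)
    (k : Fin K) {f : ℝ → ℝ} (hf : Integrable f (gaussianReal (u i k) (s k).toNNReal)) :
    Integrable (fun x => f (x i k)) (gaussianRows u s) :=
  integrable_comp_eval (μ := fun i => Measure.pi fun k => gaussianReal (u i k) (s k).toNNReal)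
    (f := fun y => f (y k))
    (integrable_comp_eval (μ := fun k => gaussianReal (u i k) (s k).toNNReal) hf)

theorem integral_comp_entry {m K : ℕ} (u : Fin m → Fin K → ℝ) (s : Fin K → ℝ) (i : Fin m)
    (k : Fin K) {f : ℝ → ℝ} (hf : Integrable f (gaussianReal (u i k) (s k).toNNReal)) :
    ∫ x, f (x i k) ∂gaussianRows u s = ∫ x, f x ∂gaussianReal (u i k) (s k).toNNReal := by
  have h := integrable_comp_eval (μ := fun k => gaussianReal (u i k) (s k).toNNReal) hf
  rw [gaussianRows, integral_comp_eval
    (μ := fun i => Measure.pi fun k => gaussianReal (u i k) (s k).toNNReal)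
    (f := fun y => f (y k)) h.aestronglyMeasurable]
  exact integral_comp_eval (μ := fun k => gaussianReal (u i k) (s k).toNNReal)
    hf.aestronglyMeasurable

theorem integrable_rowsCost {m K : ℕ} (u : Fin m → Fin K → ℝ) (s T : Fin K → ℝ) (η : ℝ) :
    Integrable (rowsCost u s T η) (gaussianRows u s) :=
  integrable_finsetSum _ fun i _ => integrable_finsetSum _ fun k _ =>
    integrable_comp_entry u s i k (integrable_gaussianCost _ _ _ _)

theorem integral_rowsCost {m K : ℕ} (u : Fin m → Fin K → ℝ) {s : Fin K → ℝ} (hs : ∀ k, 0 < s k)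
    (T : Fin K → ℝ) (η : ℝ) :
    ∫ x, rowsCost u s T η x ∂gaussianRows u s =
      ∑ i, ∑ k, (Real.log ((1 + η) * T k / s k) / 2 + (s k + u i k ^ 2) / (2 * T k) - 1 / 2) := by
  unfold rowsCost
  rw [integral_finsetSum _ fun i _ => integrable_finsetSum _ fun k _ =>
    integrable_comp_entry u s i k (integrable_gaussianCost _ _ _ _)]
  refine Finset.sum_congr rfl fun i _ => ?_
  rw [integral_finsetSum _ fun k _ =>
    integrable_comp_entry u s i k (integrable_gaussianCost _ _ _ _)]
  refine Finset.sum_congr rfl fun k _ => ?_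
  rw [integral_comp_entry u s i k (integrable_gaussianCost _ _ _ _),
    integral_gaussianCost _ _ _ (hs k)]

/-- The left side does not depend on `γ`, so the inequality can be integrated over a whole window of
variances. -/
theorem withDensity_rowsCost_le {m K : ℕ} (u : Fin m → Fin K → ℝ) {s T γ : Fin K → ℝ} {η : ℝ}
    (hs : ∀ k, 0 < s k) (hT : ∀ k, 0 < T k) (h1 : ∀ k, T k ≤ γ k)
    (h2 : ∀ k, γ k ≤ (1 + η) * T k) :
    (gaussianRows u s).withDensity (fun x => ENNReal.ofReal (Real.exp (-rowsCost u s T η x))) ≤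
      Measure.pi fun _ : Fin m => Measure.pi fun k : Fin K => gaussianReal 0 (γ k).toNNReal := by
  have hγ : ∀ k, 0 < γ k := fun k => (hT k).trans_le (h1 k)
  let G : Fin m → Fin K → ℝ → ℝ := fun i k x =>
    Real.log (γ k / s k) / 2 + x ^ 2 / (2 * γ k) - (x - u i k) ^ 2 / (2 * s k)
  have hG : ∀ i k, Measurable (G i k) := fun i k => by fun_prop
  have h3 : ∀ i, (Measure.pi fun k : Fin K => gaussianReal 0 (γ k).toNNReal) =
      (Measure.pi fun k => gaussianReal (u i k) (s k).toNNReal).withDensity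
        fun x => ENNReal.ofReal (Real.exp (-∑ k, G i k (x k))) := by
    intro i
    rw [← pi_withDensity_exp _ _ (hG i)]
    congr 1
    ext1 k
    exact gaussianReal_eq_withDensity _ (hs k) (hγ k)
  have h4 : (Measure.pi fun _ : Fin m => Measure.pi fun k : Fin K =>
      gaussianReal 0 (γ k).toNNReal) = (gaussianRows u s).withDensity
        fun x => ENNReal.ofReal (Real.exp (-∑ i, ∑ k, G i k (x i k))) := by
    rw [gaussianRows, ← pi_withDensity_exp _ (fun i (x : Fin K → ℝ) => ∑ k, G i k (x k)) fun i => by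
      have := hG i; fun_prop]
    congr 1
    ext1 i
    exact h3 i
  rw [h4]
  refine withDensity_mono (Filter.Eventually.of_forall fun x => ?_)
  refine ENNReal.ofReal_le_ofReal (Real.exp_le_exp.2 (neg_le_neg ?_))
  exact Finset.sum_le_sum fun i _ => Finset.sum_le_sum fun k _ =>
    le_gaussianCost (hs k) (hT k) (h1 k) (h2 k) _

theorem withDensity_le_gaussianFactors {m₁ m₂ K : ℕ} (q : Factors m₁ m₂ K) {s T γ : Fin K → ℝ}
    {η : ℝ} (hs : ∀ k, 0 < s k) (hT : ∀ k, 0 < T k) (h1 : ∀ k, T k ≤ γ k)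
    (h2 : ∀ k, γ k ≤ (1 + η) * T k) :
    (gaussianLaw q s).withDensity (fun p => ENNReal.ofReal
      (Real.exp (-(rowsCost q.1 s T η p.1 + rowsCost q.2 s T η p.2)))) ≤
      gaussianFactors m₁ m₂ K γ := by
  have h3 := Measure.prod_mono (withDensity_rowsCost_le q.1 hs hT h1 h2)
    (withDensity_rowsCost_le q.2 hs hT h1 h2)
  have : SFinite ((gaussianRows q.2 s).withDensity
    fun x => ENNReal.ofReal (Real.exp (-rowsCost q.2 s T η x))) := inferInstance
  rw [prod_withDensity (by fun_prop) (by fun_prop)] at h3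
  convert! h3 using 2
  ext p
  rw [neg_add, Real.exp_add, ENNReal.ofReal_mul (Real.exp_pos _).le]

/-- The prior dominates `exp (-F)` times a Gaussian law, with `F` the entrywise costs plus the cost
`c k` of the variances. -/
theorem withDensity_le_prior {m₁ m₂ K : ℕ} {a b : ℝ} (ha : 0 < a) (hb : 0 < b)
    (q : Factors m₁ m₂ K) {s T c : Fin K → ℝ} {η : ℝ} (hs : ∀ k, 0 < s k) (hT : ∀ k, 0 < T k)
    (hc : ∀ k, ENNReal.ofReal (Real.exp (-c k)) ≤
      invGammaMeasure a b (Set.Icc (T k) ((1 + η) * T k))) :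
    (gaussianLaw q s).withDensity (fun p => ENNReal.ofReal
      (Real.exp (-(rowsCost q.1 s T η p.1 + rowsCost q.2 s T η p.2 + ∑ k, c k)))) ≤
      prior m₁ m₂ K a b := by
  have : IsProbabilityMeasure (gammaMeasure a b) := isProbabilityMeasure_gammaMeasure ha hb
  have : IsProbabilityMeasure (invGammaMeasure a b) :=
    Measure.isProbabilityMeasure_map measurable_inv.aemeasurable
  -- Only the variances in this box are kept; the rest of the mixture is nonnegative and is dropped.
  set S := Set.univ.pi fun k => Set.Icc (T k) ((1 + η) * T k)
  have hS : MeasurableSet S := .univ_pi fun k => measurableSet_Icc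
  have hmass : ENNReal.ofReal (Real.exp (-∑ k, c k)) ≤
      (Measure.pi fun _ : Fin K => invGammaMeasure a b) S := by
    rw [Measure.pi_pi, ← Finset.sum_neg_distrib, Real.exp_sum,
      ENNReal.ofReal_prod_of_nonneg fun k _ => (Real.exp_pos _).le]
    exact Finset.prod_le_prod' fun k _ => hc k
  set e : Factors m₁ m₂ K → ℝ≥0∞ := fun p => ENNReal.ofReal
      (Real.exp (-(rowsCost q.1 s T η p.1 + rowsCost q.2 s T η p.2)))
  have he : Measurable e := by fun_prop
  have h1 : (gaussianLaw q s).withDensity (fun p => ENNReal.ofReal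
      (Real.exp (-(rowsCost q.1 s T η p.1 + rowsCost q.2 s T η p.2 + ∑ k, c k)))) =
      ENNReal.ofReal (Real.exp (-∑ k, c k)) • (gaussianLaw q s).withDensity e := by
    rw [← withDensity_smul _ he]
    congr 1
    ext p
    rw [Pi.smul_apply, smul_eq_mul, ← ENNReal.ofReal_mul (Real.exp_pos _).le, ← Real.exp_add]
    congr 2
    ring
  rw [h1]
  refine Measure.le_iff.2 fun A hA => ?_
  rw [prior, Measure.bind_apply hA (measurable_gaussianFactors _ _ _).aemeasurable,
    Measure.smul_apply, smul_eq_mul]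
  calc ENNReal.ofReal (Real.exp (-∑ k, c k)) * (gaussianLaw q s).withDensity e A
      ≤ (Measure.pi fun _ : Fin K => invGammaMeasure a b) S * (gaussianLaw q s).withDensity e A := by
        gcongr
    _ = ∫⁻ _ in S, (gaussianLaw q s).withDensity e A
        ∂Measure.pi fun _ : Fin K => invGammaMeasure a b := by rw [setLIntegral_const, mul_comm]
    _ ≤ ∫⁻ γ in S, gaussianFactors m₁ m₂ K γ A
        ∂Measure.pi fun _ : Fin K => invGammaMeasure a b :=
        setLIntegral_mono' hS fun γ hγ => withDensity_le_gaussianFactors q hs hT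
          (fun k => (hγ k trivial).1) (fun k => (hγ k trivial).2) A
    _ ≤ _ := setLIntegral_le_lintegral _ _

theorem isProbabilityMeasure_prior (m₁ m₂ K : ℕ) {a b : ℝ} (ha : 0 < a) (hb : 0 < b) :
    IsProbabilityMeasure (prior m₁ m₂ K a b) := by
  have : IsProbabilityMeasure (gammaMeasure a b) := isProbabilityMeasure_gammaMeasure ha hb
  have : IsProbabilityMeasure (invGammaMeasure a b) :=
    Measure.isProbabilityMeasure_map measurable_inv.aemeasurable
  have h : ∀ γ, IsProbabilityMeasure (gaussianFactors m₁ m₂ K γ) := fun γ => by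
    unfold gaussianFactors; infer_instance
  constructor
  rw [prior, Measure.bind_apply .univ (measurable_gaussianFactors _ _ _).aemeasurable]
  simp

/-! ### The risk and its mean under a Gaussian law. -/

theorem Factors.toMatrix_apply {m₁ m₂ K : ℕ} (p : Factors m₁ m₂ K) (i : Fin m₁) (j : Fin m₂) :
    p.toMatrix i j = ∑ k, p.1 i k * p.2 j k := by
  simp [Factors.toMatrix, Matrix.mul_apply]

theorem IsObservationLaw.memLp_sub {m₁ m₂ : ℕ} {M : Matrix (Fin m₁) (Fin m₂) ℝ}
    {P : Measure ((Fin m₁ × Fin m₂) × ℝ)} (h : IsObservationLaw M P)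
    (θ : Matrix (Fin m₁) (Fin m₂) ℝ) :
    MemLp (fun z : (Fin m₁ × Fin m₂) × ℝ => z.2 - θ z.1.1 z.1.2) 2 P := by
  have := h.prob
  have h1 : MemLp (fun z : (Fin m₁ × Fin m₂) × ℝ => z.2) 2 P :=
    (memLp_two_iff_integrable_sq measurable_snd.aestronglyMeasurable).2 h.sq_integrable
  have h2 : Measurable fun z : (Fin m₁ × Fin m₂) × ℝ => θ z.1.1 z.1.2 :=
    (Measurable.of_discrete (f := fun x : Fin m₁ × Fin m₂ => θ x.1 x.2)).comp measurable_fst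
  refine h1.sub (MemLp.of_bound h2.aestronglyMeasurable (∑ x : Fin m₁ × Fin m₂, ‖θ x.1 x.2‖)
    (Filter.Eventually.of_forall fun z => ?_))
  exact Finset.single_le_sum (f := fun x : Fin m₁ × Fin m₂ => ‖θ x.1 x.2‖)
    (fun _ _ => norm_nonneg _) (Finset.mem_univ z.1)

/-- The excess risk is the normalized squared Frobenius distance to `M`. -/
theorem IsObservationLaw.risk_eq {m₁ m₂ : ℕ} {M : Matrix (Fin m₁) (Fin m₂) ℝ}
    {P : Measure ((Fin m₁ × Fin m₂) × ℝ)} (h : IsObservationLaw M P)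
    (θ : Matrix (Fin m₁) (Fin m₂) ℝ) :
    risk P θ = risk P M + (m₁ * m₂ : ℝ)⁻¹ * ∑ i, ∑ j, (θ i j - M i j) ^ 2 := by
  have := h.prob
  let g : Fin m₁ × Fin m₂ → (Fin m₁ × Fin m₂) × ℝ → ℝ := fun x z =>
    2 * (M x.1 x.2 - θ x.1 x.2) * (z.2 - M x.1 x.2) + (θ x.1 x.2 - M x.1 x.2) ^ 2
  have hmeas : ∀ x : Fin m₁ × Fin m₂,
      MeasurableSet (Prod.fst ⁻¹' {x} : Set ((Fin m₁ × Fin m₂) × ℝ)) :=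
    fun x => measurable_fst (measurableSet_singleton x)
  have hlin : ∀ x : Fin m₁ × Fin m₂,
      Integrable (fun z : (Fin m₁ × Fin m₂) × ℝ => z.2 - M x.1 x.2) P := fun x =>
    ((h.memLp_sub fun _ _ => M x.1 x.2).integrable (by norm_num))
  have hg : ∀ x, Integrable (g x) P := fun x =>
    ((hlin x).const_mul _).add (integrable_const _)
  -- Splitting over the events `X = x` makes `θ_X` and `M_X` constant on each piece, where centring
  -- then removes the cross term.
  have h1 : ∀ z : (Fin m₁ × Fin m₂) × ℝ, (z.2 - θ z.1.1 z.1.2) ^ 2 =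
      (z.2 - M z.1.1 z.1.2) ^ 2 + ∑ x, (Prod.fst ⁻¹' {x}).indicator (g x) z := by
    intro z
    rw [Finset.sum_eq_single z.1]
    · rw [Set.indicator_of_mem (by simp)]
      simp only [g]
      ring
    · intro x _ hx
      exact Set.indicator_of_notMem (by simpa using hx.symm) _
    · simp
  have hreal : ∀ x : Fin m₁ × Fin m₂, P.real (Prod.fst ⁻¹' {x}) = (m₁ * m₂ : ℝ)⁻¹ := by
    intro x
    rw [measureReal_def, h.uniform]
    simp
  have h2 : ∀ x, ∫ z, (Prod.fst ⁻¹' {x}).indicator (g x) z ∂P =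
      (m₁ * m₂ : ℝ)⁻¹ * (θ x.1 x.2 - M x.1 x.2) ^ 2 := by
    intro x
    rw [integral_indicator (hmeas x), integral_add ((hlin x).const_mul _).integrableOn
      (integrable_const _).integrableOn, integral_const_mul, setIntegral_const, hreal]
    have h3 : ∫ z in Prod.fst ⁻¹' {x}, (z.2 - M x.1 x.2) ∂P = 0 := by
      rw [← h.centred x]
    rw [h3]
    simp
  unfold risk
  simp_rw [h1]
  rw [integral_add (h.memLp_sub M).integrable_sq
    (integrable_finsetSum _ fun x _ => (hg x).indicator (hmeas x)),
    integral_finsetSum _ fun x _ => (hg x).indicator (hmeas x)]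
  simp_rw [h2]
  rw [← Finset.mul_sum, Fintype.sum_prod_type]

theorem IsObservationLaw.risk_le {m₁ m₂ : ℕ} {M : Matrix (Fin m₁) (Fin m₂) ℝ}
    {P : Measure ((Fin m₁ × Fin m₂) × ℝ)} (h : IsObservationLaw M P)
    (θ : Matrix (Fin m₁) (Fin m₂) ℝ) : risk P M ≤ risk P θ := by
  rw [h.risk_eq θ]
  have : 0 ≤ (m₁ * m₂ : ℝ)⁻¹ * ∑ i, ∑ j, (θ i j - M i j) ^ 2 := by positivity
  linarith

theorem IsObservationLaw.minRisk_eq {m₁ m₂ K : ℕ} {p₀ : Factors m₁ m₂ K}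
    {P : Measure ((Fin m₁ × Fin m₂) × ℝ)} (h : IsObservationLaw p₀.toMatrix P) :
    minRisk P K = risk P p₀.toMatrix :=
  le_antisymm (ciInf_le ⟨risk P p₀.toMatrix, by rintro _ ⟨p, rfl⟩; exact h.risk_le _⟩ p₀)
    (le_ciInf fun _ => h.risk_le _)

theorem IsObservationLaw.measurable_risk {m₁ m₂ K : ℕ} {M : Matrix (Fin m₁) (Fin m₂) ℝ}
    {P : Measure ((Fin m₁ × Fin m₂) × ℝ)} (h : IsObservationLaw M P) :
    Measurable fun p : Factors m₁ m₂ K => risk P p.toMatrix := by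
  simp_rw [fun p : Factors m₁ m₂ K => h.risk_eq p.toMatrix, Factors.toMatrix_apply]
  fun_prop

/-- A bound for the mean squared error of a product of two Gaussian matrices. -/
theorem integral_sq_toMatrix_sub_le {m₁ m₂ K : ℕ} (q : Factors m₁ m₂ K) {s : Fin K → ℝ}
    (hs : ∀ k, 0 < s k) {δ τ x : ℝ} (i : Fin m₁) (j : Fin m₂)
    (hδ : ∀ k, s k * (s k + q.2 j k ^ 2) + q.1 i k ^ 2 * s k ≤ δ)
    (hτ : (q.toMatrix i j - x) ^ 2 ≤ τ) :
    Integrable (fun p : Factors m₁ m₂ K => (p.toMatrix i j - x) ^ 2) (gaussianLaw q s) ∧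
      ∫ p : Factors m₁ m₂ K, (p.toMatrix i j - x) ^ 2 ∂gaussianLaw q s ≤
        4 * K ^ 2 * δ + 2 * τ := by
  -- From `μν - uv = (μ - u) ν + u (ν - v)`: each square is a product of functions of the two
  -- independent matrices, and `s * (s + v ^ 2) + u ^ 2 * s` is the mean of `h k`.
  let h : Fin K → Factors m₁ m₂ K → ℝ := fun k p =>
    (p.1 i k - q.1 i k) ^ 2 * (p.2 j k - 0) ^ 2 + q.1 i k ^ 2 * (p.2 j k - q.2 j k) ^ 2
  have hI1 : ∀ k c, Integrable (fun y : Fin m₁ → Fin K → ℝ => (y i k - c) ^ 2)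
      (gaussianRows q.1 s) := fun k c =>
    integrable_comp_entry q.1 s i k (integrable_sub_sq_gaussianReal c _ _)
  have hI2 : ∀ k c, Integrable (fun y : Fin m₂ → Fin K → ℝ => (y j k - c) ^ 2)
      (gaussianRows q.2 s) := fun k c =>
    integrable_comp_entry q.2 s j k (integrable_sub_sq_gaussianReal c _ _)
  have hE1 : ∀ k c, ∫ y, (y i k - c) ^ 2 ∂gaussianRows q.1 s = s k + (q.1 i k - c) ^ 2 := by
    intro k c
    rw [integral_comp_entry q.1 s i k (integrable_sub_sq_gaussianReal c _ _),
      integral_sub_sq_gaussianReal _ _ (hs k)]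
  have hE2 : ∀ k c, ∫ y, (y j k - c) ^ 2 ∂gaussianRows q.2 s = s k + (q.2 j k - c) ^ 2 := by
    intro k c
    rw [integral_comp_entry q.2 s j k (integrable_sub_sq_gaussianReal c _ _),
      integral_sub_sq_gaussianReal _ _ (hs k)]
  have hA : ∀ k, Integrable (fun p : Factors m₁ m₂ K =>
      (p.1 i k - q.1 i k) ^ 2 * (p.2 j k - 0) ^ 2) (gaussianLaw q s) :=
    fun k => (hI1 k _).mul_prod (hI2 k 0)
  have hB : ∀ k, Integrable (fun p : Factors m₁ m₂ K =>
      q.1 i k ^ 2 * (p.2 j k - q.2 j k) ^ 2) (gaussianLaw q s) :=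
    fun k => (integrable_const (q.1 i k ^ 2)).mul_prod (hI2 k _)
  have hh : ∀ k, Integrable (h k) (gaussianLaw q s) := fun k => (hA k).add (hB k)
  have hEh : ∀ k, ∫ p, h k p ∂gaussianLaw q s ≤ δ := by
    intro k
    have h1 : ∫ p : Factors m₁ m₂ K, (p.1 i k - q.1 i k) ^ 2 * (p.2 j k - 0) ^ 2 ∂gaussianLaw q s =
        s k * (s k + q.2 j k ^ 2) := by
      rw [gaussianLaw, integral_prod_mul (fun y : Fin m₁ → Fin K → ℝ => (y i k - q.1 i k) ^ 2)
        (fun y : Fin m₂ → Fin K → ℝ => (y j k - 0) ^ 2), hE1, hE2]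
      ring
    have h2 : ∫ p : Factors m₁ m₂ K, q.1 i k ^ 2 * (p.2 j k - q.2 j k) ^ 2 ∂gaussianLaw q s =
        q.1 i k ^ 2 * s k := by
      rw [gaussianLaw, integral_prod_mul (fun _ : Fin m₁ → Fin K → ℝ => q.1 i k ^ 2)
        (fun y : Fin m₂ → Fin K → ℝ => (y j k - q.2 j k) ^ 2), hE2]
      simp
    rw [integral_add (hA k) (hB k), h1, h2]
    exact hδ k
  have hH : Integrable (fun p => 4 * K * ∑ k, h k p + 2 * τ) (gaussianLaw q s) :=
    ((integrable_finsetSum _ fun k _ => hh k).const_mul _).add (integrable_const _)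
  have hle : ∀ p : Factors m₁ m₂ K, (p.toMatrix i j - x) ^ 2 ≤ 4 * K * ∑ k, h k p + 2 * τ := by
    intro p
    have h1 : (p.toMatrix i j - q.toMatrix i j) ^ 2 ≤
        K * ∑ k, (p.1 i k * p.2 j k - q.1 i k * q.2 j k) ^ 2 := by
      rw [Factors.toMatrix_apply, Factors.toMatrix_apply, ← Finset.sum_sub_distrib]
      simpa using sq_sum_le_card_mul_sum_sq (s := Finset.univ)
        (f := fun k => p.1 i k * p.2 j k - q.1 i k * q.2 j k)
    have h2 : ∑ k, (p.1 i k * p.2 j k - q.1 i k * q.2 j k) ^ 2 ≤ ∑ k, 2 * h k p := by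
      refine Finset.sum_le_sum fun k _ => ?_
      simp only [h]
      nlinarith [sq_nonneg ((p.1 i k - q.1 i k) * p.2 j k - q.1 i k * (p.2 j k - q.2 j k))]
    have h3 : (p.toMatrix i j - x) ^ 2 ≤
        2 * (p.toMatrix i j - q.toMatrix i j) ^ 2 + 2 * (q.toMatrix i j - x) ^ 2 := by
      nlinarith [sq_nonneg (p.toMatrix i j - q.toMatrix i j - (q.toMatrix i j - x))]
    have h4 : K * ∑ k, (p.1 i k * p.2 j k - q.1 i k * q.2 j k) ^ 2 ≤ K * ∑ k, 2 * h k p := by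
      gcongr
    rw [← Finset.mul_sum] at h4
    linarith
  have hint : Integrable (fun p : Factors m₁ m₂ K => (p.toMatrix i j - x) ^ 2)
      (gaussianLaw q s) := by
    refine hH.mono' ?_ (Filter.Eventually.of_forall fun p => ?_)
    · simp_rw [Factors.toMatrix_apply]
      exact Measurable.aestronglyMeasurable (by fun_prop)
    · rw [Real.norm_of_nonneg (sq_nonneg _)]
      exact hle p
  refine ⟨hint, (integral_mono hint hH hle).trans ?_⟩
  rw [integral_add ((integrable_finsetSum _ fun k _ => hh k).const_mul _) (integrable_const _),
    integral_const_mul, integral_finsetSum _ fun k _ => hh k]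
  have h5 : ∑ k, ∫ p, h k p ∂gaussianLaw q s ≤ K * δ := by
    simpa using Finset.sum_le_sum fun k (_ : k ∈ Finset.univ) => hEh k
  have h6 : (4 * K : ℝ) * ∑ k, ∫ p, h k p ∂gaussianLaw q s ≤ 4 * K * (K * δ) := by gcongr
  simp
  linarith

theorem IsObservationLaw.integral_risk_sub_le {m₁ m₂ K : ℕ} {M : Matrix (Fin m₁) (Fin m₂) ℝ}
    {P : Measure ((Fin m₁ × Fin m₂) × ℝ)} (h : IsObservationLaw M P) (hm₁ : 0 < m₁) (hm₂ : 0 < m₂)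
    (q : Factors m₁ m₂ K) {s : Fin K → ℝ} (hs : ∀ k, 0 < s k) {δ τ : ℝ}
    (hδ : ∀ i j k, s k * (s k + q.2 j k ^ 2) + q.1 i k ^ 2 * s k ≤ δ)
    (hτ : ∀ i j, (q.toMatrix i j - M i j) ^ 2 ≤ τ) :
    Integrable (fun p : Factors m₁ m₂ K => risk P p.toMatrix) (gaussianLaw q s) ∧
      ∫ p : Factors m₁ m₂ K, (risk P p.toMatrix - risk P M) ∂gaussianLaw q s ≤
        4 * K ^ 2 * δ + 2 * τ := by
  have h1 := fun i j => integral_sq_toMatrix_sub_le q hs i j (hδ i j) (hτ i j)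
  have h2 : Integrable (fun p : Factors m₁ m₂ K =>
      (m₁ * m₂ : ℝ)⁻¹ * ∑ i, ∑ j, (p.toMatrix i j - M i j) ^ 2) (gaussianLaw q s) :=
    (integrable_finsetSum _ fun i _ => integrable_finsetSum _ fun j _ => (h1 i j).1).const_mul _
  simp_rw [fun p : Factors m₁ m₂ K => h.risk_eq p.toMatrix]
  refine ⟨(integrable_const _).add h2, ?_⟩
  simp_rw [add_sub_cancel_left]
  rw [integral_const_mul, integral_finsetSum _ fun i _ => integrable_finsetSum _ fun j _ => (h1 i j).1]
  simp_rw [fun i => integral_finsetSum Finset.univ fun j _ => (h1 i j).1]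
  calc _ ≤ (m₁ * m₂ : ℝ)⁻¹ * ∑ _i : Fin m₁, ∑ _j : Fin m₂, (4 * K ^ 2 * δ + 2 * τ) := by
        gcongr with i _ j _
        exact (h1 i j).2
    _ = _ := by
        simp only [Finset.sum_const, Finset.card_univ, Fintype.card_fin, nsmul_eq_mul]
        field_simp

/-! ### From the prior to the Gibbs posterior and the PAC-Bayes bounds. -/

theorem withDensity_mono_measure {α : Type*} [MeasurableSpace α] {μ ν : Measure α} (h : μ ≤ ν)
    (f : α → ℝ≥0∞) : μ.withDensity f ≤ ν.withDensity f := by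
  refine Measure.le_iff.2 fun s hs => ?_
  rw [withDensity_apply _ hs, withDensity_apply _ hs]
  exact lintegral_mono' (Measure.restrict_mono le_rfl h) le_rfl

section Reduction

variable {m₁ m₂ K : ℕ} {p₀ : Factors m₁ m₂ K} {P : Measure ((Fin m₁ × Fin m₂) × ℝ)}
  {π ρ : Measure (Factors m₁ m₂ K)} [IsProbabilityMeasure ρ]
  {β : ℝ}

/-- The risk is minimal at `M`, so the normalising constant of `gibbs` is at most `exp (-β R(M))`.
-/
theorem IsObservationLaw.withDensity_le_gibbs [IsProbabilityMeasure π] (h : IsObservationLaw p₀.toMatrix P) (hβ : 0 < β) :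
    π.withDensity (fun p => ENNReal.ofReal
      (Real.exp (-(β * (risk P p.toMatrix - risk P p₀.toMatrix))))) ≤ gibbs P π β := by
  have hm := h.measurable_risk (K := K)
  have hint : Integrable (fun p : Factors m₁ m₂ K => Real.exp (-β * risk P p.toMatrix)) π := by
    refine Integrable.of_bound (Measurable.aestronglyMeasurable (by fun_prop))
      (Real.exp (-β * risk P p₀.toMatrix)) (Filter.Eventually.of_forall fun p => ?_)
    rw [Real.norm_of_nonneg (Real.exp_pos _).le, Real.exp_le_exp]
    nlinarith [h.risk_le p.toMatrix]
  have hZ : ∫ p : Factors m₁ m₂ K, Real.exp (-β * risk P p.toMatrix) ∂π ≤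
      Real.exp (-β * risk P p₀.toMatrix) := by
    refine (integral_mono hint (integrable_const (Real.exp (-β * risk P p₀.toMatrix)))
      fun p => ?_).trans (by simp)
    rw [Real.exp_le_exp]
    nlinarith [h.risk_le p.toMatrix]
  have hZ0 : 0 < ∫ p : Factors m₁ m₂ K, Real.exp (-β * risk P p.toMatrix) ∂π :=
    integral_exp_pos hint
  refine withDensity_mono (Filter.Eventually.of_forall fun p => ENNReal.ofReal_le_ofReal ?_)
  rw [le_div_iff₀ hZ0]
  calc _ ≤ Real.exp (-(β * (risk P p.toMatrix - risk P p₀.toMatrix))) *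
        Real.exp (-β * risk P p₀.toMatrix) := by gcongr
    _ = _ := by rw [← Real.exp_add]; congr 1; ring

theorem IsObservationLaw.isProbabilityMeasure_gibbs [IsProbabilityMeasure π] (h : IsObservationLaw p₀.toMatrix P)
    (hβ : 0 < β) : IsProbabilityMeasure (gibbs P π β) := by
  have hm := h.measurable_risk (K := K)
  refine isProbabilityMeasure_tilted (Integrable.of_bound
    (Measurable.aestronglyMeasurable (by fun_prop)) (Real.exp (-β * risk P p₀.toMatrix))
    (Filter.Eventually.of_forall fun p => ?_))
  rw [Real.norm_of_nonneg (Real.exp_pos _).le, Real.exp_le_exp]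
  nlinarith [h.risk_le p.toMatrix]

variable {F : Factors m₁ m₂ K → ℝ} {κ D : ℝ}

/-- The dominations of `ρ` by `π` and of `π` by `gibbs` compose, and their exponents add. -/
theorem IsObservationLaw.klDiv_gibbs_le [IsProbabilityMeasure π] (h : IsObservationLaw p₀.toMatrix P) (hβ : 0 < β)
    (hR : Integrable (fun p : Factors m₁ m₂ K => risk P p.toMatrix) ρ) (hFm : Measurable F)
    (hF : Integrable F ρ)
    (hle : ρ.withDensity (fun p => ENNReal.ofReal (Real.exp (-F p))) ≤ π)
    (hκ : ∫ p, F p ∂ρ ≤ κ)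
    (hD : β * ∫ p : Factors m₁ m₂ K, (risk P p.toMatrix - risk P p₀.toMatrix) ∂ρ + κ ≤ D) :
    klDiv ρ (gibbs P π β) ≤ ENNReal.ofReal D := by
  have := h.isProbabilityMeasure_gibbs (π := π) hβ
  have hm := h.measurable_risk (K := K)
  have hR' : Integrable (fun p : Factors m₁ m₂ K =>
      β * (risk P p.toMatrix - risk P p₀.toMatrix)) ρ :=
    (hR.sub (integrable_const _)).const_mul β
  have h1 : ρ.withDensity (fun p => ENNReal.ofReal (Real.exp
      (-(β * (risk P p.toMatrix - risk P p₀.toMatrix) + F p)))) ≤ gibbs P π β := by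
    refine le_trans (le_of_eq ?_)
      ((withDensity_mono_measure hle _).trans (h.withDensity_le_gibbs hβ))
    rw [← withDensity_mul _ (by fun_prop) (by fun_prop)]
    congr 1
    ext p
    rw [Pi.mul_apply, ← ENNReal.ofReal_mul (Real.exp_pos _).le, ← Real.exp_add]
    congr 2
    ring
  refine (klDiv_le_of_withDensity_le (by fun_prop) (hR'.add hF) h1).trans
    (ENNReal.ofReal_le_ofReal ?_)
  have h2 := integral_add hR' hF
  rw [integral_const_mul] at h2
  exact h2.le.trans (by linarith)

theorem IsObservationLaw.lintegral_risk_sub (h : IsObservationLaw p₀.toMatrix P)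
    (hR : Integrable (fun p : Factors m₁ m₂ K => risk P p.toMatrix) ρ) :
    ∫⁻ p : Factors m₁ m₂ K, ENNReal.ofReal (risk P p.toMatrix - risk P p₀.toMatrix) ∂ρ =
      ENNReal.ofReal
        (∫ p : Factors m₁ m₂ K, (risk P p.toMatrix - risk P p₀.toMatrix) ∂ρ) :=
  (ofReal_integral_eq_lintegral_ofReal (hR.sub (integrable_const _))
    (Filter.Eventually.of_forall fun p => sub_nonneg.2 (h.risk_le p.toMatrix))).symm

/-- Since the risk is at least `R(M)` and the divergence is nonnegative, even the infimum over all
laws exceeds the value with risk `R(M)` and no divergence. With `lam = 2 * β`, the surplus paid by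
`ρ` is at most `2 / lam` times `β E + κ`. -/
theorem IsObservationLaw.slowBound_le (h : IsObservationLaw p₀.toMatrix P) (hβ : 0 < β)
    (hρ : ρ ∈ meanField m₁ m₂ K)
    (hR : Integrable (fun p : Factors m₁ m₂ K => risk P p.toMatrix) ρ)
    (hκ0 : 0 ≤ κ) (hkl : klDiv ρ π ≤ ENNReal.ofReal κ)
    (hD : β * ∫ p : Factors m₁ m₂ K, (risk P p.toMatrix - risk P p₀.toMatrix) ∂ρ + κ ≤ D)
    {lam f ε : ℝ} (hlam : lam = 2 * β) :
    slowBound P π lam f ε (meanField m₁ m₂ K) ≤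
      slowBound P π lam f ε (allLaws m₁ m₂ K) + ENNReal.ofReal (2 / lam * D) := by
  have hlam0 : 0 < lam := by linarith
  set E := ∫ p : Factors m₁ m₂ K, (risk P p.toMatrix - risk P p₀.toMatrix) ∂ρ
  have hE : 0 ≤ E := integral_nonneg fun p => sub_nonneg.2 (h.risk_le p.toMatrix)
  have hrisk0 : ∀ θ, 0 ≤ risk P θ := fun θ => integral_nonneg fun z => sq_nonneg _
  have hlow : ENNReal.ofReal (risk P p₀.toMatrix) + 2 * (ENNReal.ofReal f +
      ENNReal.ofReal (Real.log (2 / ε))) / ENNReal.ofReal lam ≤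
      slowBound P π lam f ε (allLaws m₁ m₂ K) := by
    refine le_iInf₂ fun μ hμ => ?_
    have : IsProbabilityMeasure μ := hμ
    have h1 : ENNReal.ofReal (risk P p₀.toMatrix) ≤
        ∫⁻ p : Factors m₁ m₂ K, ENNReal.ofReal (risk P p.toMatrix) ∂μ := by
      calc ENNReal.ofReal (risk P p₀.toMatrix)
          = ∫⁻ _ : Factors m₁ m₂ K, ENNReal.ofReal (risk P p₀.toMatrix) ∂μ := by simp
        _ ≤ _ := lintegral_mono fun p => ENNReal.ofReal_le_ofReal (h.risk_le _)
    gcongr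
    exact le_self_add
  refine (iInf₂_le ρ hρ).trans (le_trans ?_ (add_le_add_left hlow _))
  have h2 : ∫⁻ p : Factors m₁ m₂ K, ENNReal.ofReal (risk P p.toMatrix) ∂ρ =
      ENNReal.ofReal (risk P p₀.toMatrix) + ENNReal.ofReal E := by
    rw [← ENNReal.ofReal_add (hrisk0 _) hE, ← ofReal_integral_eq_lintegral_ofReal hR
      (Filter.Eventually.of_forall fun p => hrisk0 _)]
    congr 1
    simp only [E]
    rw [integral_sub hR (integrable_const _)]
    simp
  have h3 : ENNReal.ofReal E + 2 * ENNReal.ofReal κ / ENNReal.ofReal lam ≤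
      ENNReal.ofReal (2 / lam * D) := by
    rw [← ENNReal.ofReal_ofNat 2, ← ENNReal.ofReal_mul zero_le_two,
      ← ENNReal.ofReal_div_of_pos hlam0, ← ENNReal.ofReal_add hE (by positivity)]
    refine ENNReal.ofReal_le_ofReal ?_
    have : E + 2 * κ / lam = 2 / lam * (β * E + κ) := by
      rw [hlam]; field_simp
    rw [this]
    gcongr
  calc _ ≤ ENNReal.ofReal (risk P p₀.toMatrix) + ENNReal.ofReal E +
        2 * (ENNReal.ofReal f + ENNReal.ofReal κ + ENNReal.ofReal (Real.log (2 / ε))) /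
          ENNReal.ofReal lam := by rw [h2]; gcongr
    _ = ENNReal.ofReal (risk P p₀.toMatrix) + 2 * (ENNReal.ofReal f +
        ENNReal.ofReal (Real.log (2 / ε))) / ENNReal.ofReal lam +
        (ENNReal.ofReal E + 2 * ENNReal.ofReal κ / ENNReal.ofReal lam) := by
        simp only [div_eq_mul_inv]; ring
    _ ≤ _ := by gcongr

/-- The comparison is that of `slowBound_le`; as `minRisk` equals `R(M)`, the excess risk is
nonnegative and only the `ε` term is left in the lower bound over all laws. -/
theorem IsObservationLaw.fastBound_le (h : IsObservationLaw p₀.toMatrix P)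
    (hρ : ρ ∈ meanField m₁ m₂ K)
    (hR : Integrable (fun p : Factors m₁ m₂ K => risk P p.toMatrix) ρ)
    (hκ0 : 0 ≤ κ) (hβ : 0 < β) (hkl : klDiv ρ π ≤ ENNReal.ofReal κ)
    (hD : β * ∫ p : Factors m₁ m₂ K, (risk P p.toMatrix - risk P p₀.toMatrix) ∂ρ + κ ≤ D)
    {lam g ε : ℝ} (hlam : lam + g = 2 * β) (hg : 0 < lam - g) :
    fastBound P π lam g ε (meanField m₁ m₂ K) ≤
      fastBound P π lam g ε (allLaws m₁ m₂ K) + ENNReal.ofReal (2 / (lam - g) * D) := by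
  set E := ∫ p : Factors m₁ m₂ K, (risk P p.toMatrix - risk P p₀.toMatrix) ∂ρ with hEdef
  have hE : 0 ≤ E := integral_nonneg fun p => sub_nonneg.2 (h.risk_le p.toMatrix)
  have hlow : 2 * ENNReal.ofReal (Real.log (2 / ε)) / ENNReal.ofReal (lam - g) ≤
      fastBound P π lam g ε (allLaws m₁ m₂ K) := by
    refine ENNReal.div_le_div_right (le_iInf₂ fun μ _ => le_add_self) _
  refine le_trans ?_ (add_le_add_left hlow _)
  have h3 : (ENNReal.ofReal (lam + g) * ENNReal.ofReal E + 2 * ENNReal.ofReal κ) /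
      ENNReal.ofReal (lam - g) ≤ ENNReal.ofReal (2 / (lam - g) * D) := by
    rw [← ENNReal.ofReal_ofNat 2, ← ENNReal.ofReal_mul zero_le_two,
      ← ENNReal.ofReal_mul (by linarith), ← ENNReal.ofReal_add (mul_nonneg (by linarith) hE)
        (by positivity), ← ENNReal.ofReal_div_of_pos hg]
    refine ENNReal.ofReal_le_ofReal ?_
    have : ((lam + g) * E + 2 * κ) / (lam - g) = 2 / (lam - g) * (β * E + κ) := by
      rw [hlam]; ring
    rw [this]
    gcongr
  calc fastBound P π lam g ε (meanField m₁ m₂ K)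
      ≤ (ENNReal.ofReal (lam + g) * ENNReal.ofReal E + 2 * ENNReal.ofReal κ +
        2 * ENNReal.ofReal (Real.log (2 / ε))) / ENNReal.ofReal (lam - g) := by
        refine ENNReal.div_le_div_right ((iInf₂_le ρ hρ).trans ?_) _
        rw [h.minRisk_eq, h.lintegral_risk_sub hR]
        gcongr
    _ = 2 * ENNReal.ofReal (Real.log (2 / ε)) / ENNReal.ofReal (lam - g) +
        (ENNReal.ofReal (lam + g) * ENNReal.ofReal E + 2 * ENNReal.ofReal κ) /
          ENNReal.ofReal (lam - g) := by rw [← ENNReal.add_div, add_comm]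
    _ ≤ _ := by gcongr

/-- The mass of `exp (-F) ρ` is at most one and `exp (-F) ≥ 1 - F`. The sign is needed so that
`ENNReal.ofReal` does not truncate the divergence bound. -/
theorem integral_nonneg_of_withDensity_le [IsProbabilityMeasure π] (hFm : Measurable F) (hF : Integrable F ρ)
    (hle : ρ.withDensity (fun p => ENNReal.ofReal (Real.exp (-F p))) ≤ π) :
    0 ≤ ∫ p, F p ∂ρ := by
  have h1 : ∫⁻ p, ENNReal.ofReal (Real.exp (-F p)) ∂ρ ≤ 1 := by
    have := hle Set.univ
    rwa [withDensity_apply _ .univ, Measure.restrict_univ, measure_univ] at this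
  have hF1 : Integrable (fun p => 1 - F p) ρ := (integrable_const _).sub hF
  have hexp : Integrable (fun p => Real.exp (-F p)) ρ := by
    refine ⟨Measurable.aestronglyMeasurable (by fun_prop), ?_⟩
    rw [hasFiniteIntegral_iff_ofReal (Filter.Eventually.of_forall fun p => (Real.exp_pos _).le)]
    exact h1.trans_lt ENNReal.one_lt_top
  have h2 : ∫ p, (1 - F p) ∂ρ ≤ 1 := by
    refine (integral_mono hF1 hexp fun p => ?_).trans ?_
    · have := Real.add_one_le_exp (-F p)
      linarith
    · rw [integral_eq_lintegral_of_nonneg_ae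
        (Filter.Eventually.of_forall fun p => (Real.exp_pos _).le) hexp.aestronglyMeasurable]
      exact ENNReal.toReal_mono ENNReal.one_ne_top h1
  rw [integral_sub (integrable_const _) hF] at h2
  simpa using h2

end Reduction

/-! ### Factorization of `M` with `r` nonzero columns. -/

/-- A rank factorization with controlled entries: project the columns on an orthonormal basis of
the column space. -/
theorem exists_rank_factorization {m₁ m₂ r : ℕ} (M : Matrix (Fin m₁) (Fin m₂) ℝ)
    (hr : M.rank = r) {B : ℝ} (hB : ∀ i j, |M i j| ≤ B) :
    ∃ (U : Fin m₁ → Fin r → ℝ) (V : Fin m₂ → Fin r → ℝ), (∀ i l, |U i l| ≤ 1) ∧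
      (∀ j l, |V j l| ≤ m₁ * B) ∧ ∀ i j, M i j = ∑ l, U i l * V j l := by
  let e := WithLp.linearEquiv 2 ℝ (Fin m₁ → ℝ)
  let S : Submodule ℝ (EuclideanSpace ℝ (Fin m₁)) :=
    (Submodule.span ℝ (Set.range M.col)).map (e.symm : (Fin m₁ → ℝ) →ₗ[ℝ] _)
  have hS : Module.finrank ℝ S = r := by
    rw [← hr, Matrix.rank_eq_finrank_span_cols]
    exact LinearEquiv.finrank_map_eq _ _
  -- With `r` replaced by the dimension, `Fin r` indexes `stdOrthonormalBasis`.
  subst hS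
  let b := stdOrthonormalBasis ℝ S
  have hcol : ∀ j, e.symm (M.col j) ∈ S := fun j =>
    Submodule.mem_map_of_mem (Submodule.subset_span ⟨j, rfl⟩)
  have hU : ∀ i l, |(b l : EuclideanSpace ℝ (Fin m₁)) i| ≤ 1 := by
    intro i l
    have h1 : ‖(b l : EuclideanSpace ℝ (Fin m₁))‖ = 1 := b.norm_eq_one l
    rw [← h1]
    exact PiLp.norm_apply_le (b l : EuclideanSpace ℝ (Fin m₁)) i
  refine ⟨fun i l => (b l : EuclideanSpace ℝ (Fin m₁)) i,
    fun j l => inner ℝ (b l) (⟨e.symm (M.col j), hcol j⟩ : S), hU, fun j l => ?_, fun i j => ?_⟩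
  · have h2 : inner ℝ (b l) (⟨e.symm (M.col j), hcol j⟩ : S) =
        ∑ i, M i j * (b l : EuclideanSpace ℝ (Fin m₁)) i := by
      rw [Submodule.coe_inner, PiLp.inner_apply]
      rfl
    simp only [h2]
    calc |∑ i, M i j * (b l : EuclideanSpace ℝ (Fin m₁)) i|
        ≤ ∑ i, |M i j * (b l : EuclideanSpace ℝ (Fin m₁)) i| := Finset.abs_sum_le_sum_abs _ _
      _ ≤ ∑ _i : Fin m₁, B * 1 := by
          refine Finset.sum_le_sum fun i _ => ?_
          rw [abs_mul]
          exact mul_le_mul (hB i j) (hU i l) (abs_nonneg _) ((abs_nonneg _).trans (hB i j))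
      _ = m₁ * B := by simp
  · have h3 := congrArg (fun x : S => (x : EuclideanSpace ℝ (Fin m₁)) i)
      (b.sum_repr' ⟨e.symm (M.col j), hcol j⟩)
    simp only [Submodule.coe_sum, Submodule.coe_smul, WithLp.ofLp_sum, Finset.sum_apply,
      PiLp.smul_apply, smul_eq_mul] at h3
    have h4 : (e.symm (M.col j)) i = M i j := rfl
    rw [← h4, ← h3]
    exact Finset.sum_congr rfl fun l _ => mul_comm _ _

theorem sum_fin_dite {r K : ℕ} (hrK : r ≤ K) (f : Fin r → ℝ) :
    ∑ k : Fin K, (if h : (k : ℕ) < r then f ⟨k, h⟩ else 0) = ∑ l, f l := by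
  rw [Fin.sum_univ_eq_sum_range (fun n => if h : n < r then f ⟨n, h⟩ else 0) K,
    ← Finset.sum_subset (Finset.range_mono hrK) fun x _ hx => dif_neg (by simpa using hx),
    ← Fin.sum_univ_eq_sum_range]
  simp

/-- `exists_rank_factorization` with the factors padded by zero columns. -/
theorem exists_padded_rank_factorization {m₁ m₂ K r : ℕ} (M : Matrix (Fin m₁) (Fin m₂) ℝ)
    (hr : M.rank = r) (hrK : r ≤ K) {B : ℝ} (hB0 : 0 ≤ B) (hB : ∀ i j, |M i j| ≤ B) :
    ∃ q : Factors m₁ m₂ K, (∀ i k, |q.1 i k| ≤ 1) ∧ (∀ j k, |q.2 j k| ≤ m₁ * B) ∧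
      (∀ i (k : Fin K), r ≤ k → q.1 i k = 0) ∧ (∀ j (k : Fin K), r ≤ k → q.2 j k = 0) ∧
      q.toMatrix = M := by
  obtain ⟨U, V, hU, hV, hM⟩ := exists_rank_factorization M hr hB
  refine ⟨(fun i k => if h : (k : ℕ) < r then U i ⟨k, h⟩ else 0,
    fun j k => if h : (k : ℕ) < r then V j ⟨k, h⟩ else 0), fun i k => ?_, fun j k => ?_,
    fun i k hk => dif_neg hk.not_gt, fun j k hk => dif_neg hk.not_gt, ?_⟩
  · dsimp only
    split_ifs
    · exact hU _ _
    · simp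
  · dsimp only
    split_ifs
    · exact hV _ _
    · simpa using by positivity
  · ext i j
    rw [Factors.toMatrix_apply, hM, ← sum_fin_dite hrK]
    refine Finset.sum_congr rfl fun k _ => ?_
    dsimp only
    split_ifs <;> simp

/-! ### The Gaussian trial law and its cost. -/

/-- The mean-field approximation of the Gibbs posterior and of the PAC-Bayes bounds is tight up to
`D`. -/
def VariationalBounds {m₁ m₂ K : ℕ} (P : Measure ((Fin m₁ × Fin m₂) × ℝ))
    (π : Measure (Factors m₁ m₂ K)) (β D : ℝ) : Prop :=
  (⨅ ρ ∈ meanField m₁ m₂ K, klDiv ρ (gibbs P π β)) ≤ ENNReal.ofReal D ∧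
    (∀ lam f ε : ℝ, lam = 2 * β → 0 ≤ f → 0 < ε → ε < 1 →
      slowBound P π lam f ε (meanField m₁ m₂ K) ≤
        slowBound P π lam f ε (allLaws m₁ m₂ K) + ENNReal.ofReal (2 / lam * D)) ∧
    (∀ lam g ε : ℝ, lam + g = 2 * β → 0 < lam - g → 0 < ε → ε < 1 →
      fastBound P π lam g ε (meanField m₁ m₂ K) ≤
        fastBound P π lam g ε (allLaws m₁ m₂ K) + ENNReal.ofReal (2 / (lam - g) * D))

/-- Minus the logarithm of the constant in `le_invGammaMeasure_Icc`. -/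
noncomputable def invGammaCost (a : ℝ) : ℝ :=
  -Real.log ((2 : ℝ) ^ (-a - 1) * Real.exp (-1) / Real.Gamma a)

/-- The relative width `1 / n` costs only `log n` per column, and `T = b` removes the other
logarithm. -/
theorem le_invGammaMeasure_Icc_of_cost {a b T n : ℝ} (ha : 0 < a) (hb : 0 < b) (hbT : b ≤ T)
    (hn : 1 ≤ n) :
    ENNReal.ofReal (Real.exp (-(invGammaCost a + a * Real.log (T / b) + Real.log n))) ≤
      invGammaMeasure a b (Set.Icc T ((1 + 1 / n) * T)) := by
  have hT : 0 < T := hb.trans_le hbT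
  have hΓ := Real.Gamma_pos_of_pos ha
  have hn0 : 0 < n := by linarith
  refine le_trans (ENNReal.ofReal_le_ofReal (le_of_eq ?_))
    (le_invGammaMeasure_Icc ha hb hbT (by positivity) ((div_le_one hn0).2 hn))
  rw [invGammaCost, show -(-Real.log ((2 : ℝ) ^ (-a - 1) * Real.exp (-1) / Real.Gamma a) +
      a * Real.log (T / b) + Real.log n) = Real.log ((2 : ℝ) ^ (-a - 1) * Real.exp (-1) /
      Real.Gamma a) + Real.log (b / T) * a + Real.log (1 / n) by
    rw [← inv_div T b, Real.log_inv, one_div, Real.log_inv]; ring]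
  rw [Real.exp_add, Real.exp_add, Real.exp_log (by positivity), Real.exp_log (by positivity),
    ← Real.rpow_def_of_pos (by positivity)]

theorem sum_fin_ite {r K : ℕ} (hrK : r ≤ K) (x : ℝ) :
    ∑ k : Fin K, (if (k : ℕ) < r then x else 0) = r * x := by
  have := sum_fin_dite hrK fun _ => x
  simpa using this

section Trial

variable {m₁ m₂ K r : ℕ} {p₀ : Factors m₁ m₂ K} {P : Measure ((Fin m₁ × Fin m₂) × ℝ)}
  {a b β s T τ : ℝ}

/-- A Gaussian mean-field trial law centred at factors `q` of which only the first `r` columns do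
not vanish, with variance `s` on these columns and `b` elsewhere. -/
theorem IsObservationLaw.variationalBounds_of_trial (h : IsObservationLaw p₀.toMatrix P)
    (ha : 0 < a) (hb : 0 < b) (hβ : 0 < β) (hm₁ : 0 < m₁) (hm₂ : 0 < m₂) (hrK : r ≤ K)
    (q : Factors m₁ m₂ K) (hbT : b ≤ T) (hs : 0 < s) (hsT : s ≤ T)
    (hq₁ : ∀ i k, q.1 i k ^ 2 ≤ T) (hq₂ : ∀ j k, q.2 j k ^ 2 ≤ T)
    (hz₁ : ∀ i (k : Fin K), r ≤ k → q.1 i k = 0) (hz₂ : ∀ j (k : Fin K), r ≤ k → q.2 j k = 0)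
    (hτ : ∀ i j, (q.toMatrix i j - p₀.toMatrix i j) ^ 2 ≤ τ) {D : ℝ}
    (hD : β * (4 * K ^ 2 * (3 * s * T + b ^ 2) + 2 * τ) +
      (K * (invGammaCost a + Real.log (m₁ + m₂) + 1 / 2) + r * (a * Real.log (T / b) +
        (m₁ + m₂) * (Real.log (T / s) + 1) / 2)) ≤ D) :
    VariationalBounds P (prior m₁ m₂ K a b) β D := by
  have hT : 0 < T := hs.trans_le hsT
  have := isProbabilityMeasure_prior m₁ m₂ K ha hb
  set n : ℝ := (m₁ : ℝ) + m₂ with hn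
  have hn1 : 1 ≤ n := by
    have h1 : (1 : ℝ) ≤ m₁ := by exact_mod_cast hm₁
    have h2 : (0 : ℝ) ≤ m₂ := by positivity
    linarith
  have hn0 : 0 < n := by linarith
  let s' : Fin K → ℝ := fun k => if (k : ℕ) < r then s else b
  -- On null columns the window starts at the trial variance `b` itself, so that `T' k / s' k` and
  -- `T' k / b` are both `1`.
  let T' : Fin K → ℝ := fun k => if (k : ℕ) < r then T else b
  let c : Fin K → ℝ := fun k => invGammaCost a + a * Real.log (T' k / b) + Real.log n
  have hs' : ∀ k, 0 < s' k := fun k => by simp only [s']; split_ifs <;> assumption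
  have hT' : ∀ k, 0 < T' k := fun k => by simp only [T']; split_ifs <;> assumption
  have hbT' : ∀ k, b ≤ T' k := fun k => by
    simp only [T']; split_ifs
    · exact hbT
    · exact le_rfl
  let F : Factors m₁ m₂ K → ℝ := fun p =>
    rowsCost q.1 s' T' (1 / n) p.1 + rowsCost q.2 s' T' (1 / n) p.2 + ∑ k, c k
  have hFm : Measurable F := by fun_prop
  have hI1 : Integrable (fun p : Factors m₁ m₂ K => rowsCost q.1 s' T' (1 / n) p.1)
      (gaussianLaw q s') := (integrable_rowsCost q.1 s' T' (1 / n)).comp_fst _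
  have hI2 : Integrable (fun p : Factors m₁ m₂ K => rowsCost q.2 s' T' (1 / n) p.2)
      (gaussianLaw q s') := (integrable_rowsCost q.2 s' T' (1 / n)).comp_snd _
  have hF : Integrable F (gaussianLaw q s') := (hI1.add hI2).add (integrable_const _)
  have hle := withDensity_le_prior ha hb q hs' hT' (c := c) fun k =>
    le_invGammaMeasure_Icc_of_cost ha hb (hbT' k) hn1
  have hentry : ∀ (u : ℝ) (k : Fin K), u ^ 2 ≤ T → (r ≤ k → u = 0) →
      Real.log ((1 + 1 / n) * T' k / s' k) / 2 + (s' k + u ^ 2) / (2 * T' k) - 1 / 2 ≤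
        1 / (2 * n) + if (k : ℕ) < r then (Real.log (T / s) + 1) / 2 else 0 := by
    intro u k hu hu0
    have h1 : Real.log ((1 + 1 / n) * T' k / s' k) ≤ 1 / n + Real.log (T' k / s' k) := by
      rw [mul_div_assoc, Real.log_mul (by positivity) (div_pos (hT' k) (hs' k)).ne']
      have := Real.log_le_sub_one_of_pos (show 0 < 1 + 1 / n by positivity)
      linarith
    have h2 : 1 / (2 * n) = 1 / n / 2 := by field_simp
    rw [h2]
    by_cases hk : (k : ℕ) < r
    · simp only [s', T', hk, if_true] at h1 ⊢
      have h3 : (s + u ^ 2) / (2 * T) ≤ 1 := by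
        rw [div_le_one (by positivity)]; linarith
      linarith
    · have hb2 : (b + 0 ^ 2) / (2 * b) = 1 / 2 := by field_simp; ring
      simp only [s', T', hk, if_false, hu0 (not_lt.1 hk), hb2] at h1 ⊢
      rw [div_self hb.ne', Real.log_one] at h1
      linarith
  have hsum : ∀ (m : ℕ) (u : Fin m → Fin K → ℝ), (∀ i k, u i k ^ 2 ≤ T) →
      (∀ i (k : Fin K), r ≤ k → u i k = 0) →
      ∫ x, rowsCost u s' T' (1 / n) x ∂gaussianRows u s' ≤
        m * (K * (1 / (2 * n)) + r * ((Real.log (T / s) + 1) / 2)) := by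
    intro m u hu hu0
    rw [integral_rowsCost u hs' T' (1 / n)]
    calc _ ≤ ∑ _i : Fin m, ∑ k : Fin K,
          (1 / (2 * n) + if (k : ℕ) < r then (Real.log (T / s) + 1) / 2 else 0) :=
          Finset.sum_le_sum fun i _ => Finset.sum_le_sum fun k _ =>
            hentry _ k (hu i k) (hu0 i k)
      _ = _ := by
          simp only [Finset.sum_add_distrib, sum_fin_ite hrK]
          simp
          ring
  have hc : ∑ k, c k = K * (invGammaCost a + Real.log n) + r * (a * Real.log (T / b)) := by
    have h1 : ∀ k, c k = (invGammaCost a + Real.log n) +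
        if (k : ℕ) < r then a * Real.log (T / b) else 0 := by
      intro k
      simp only [c, T']
      split_ifs
      · ring
      · rw [div_self hb.ne', Real.log_one]; ring
    simp_rw [h1]
    rw [Finset.sum_add_distrib, sum_fin_ite hrK]
    simp
    ring
  have hκ : ∫ p, F p ∂gaussianLaw q s' ≤
      K * (invGammaCost a + Real.log n + 1 / 2) + r * (a * Real.log (T / b) +
        n * (Real.log (T / s) + 1) / 2) := by
    have h1 : ∫ p, F p ∂gaussianLaw q s' = ∫ x, rowsCost q.1 s' T' (1 / n) x ∂gaussianRows q.1 s' +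
        ∫ x, rowsCost q.2 s' T' (1 / n) x ∂gaussianRows q.2 s' + ∑ k, c k := by
      have h2 := integral_add (hI1.add hI2) (integrable_const (∑ k, c k))
      have h3 := integral_add hI1 hI2
      have h4 : ∫ p : Factors m₁ m₂ K, rowsCost q.1 s' T' (1 / n) p.1 ∂gaussianLaw q s' =
          ∫ x, rowsCost q.1 s' T' (1 / n) x ∂gaussianRows q.1 s' := by
        rw [gaussianLaw, integral_fun_fst (f := rowsCost q.1 s' T' (1 / n))]
        simp
      have h5 : ∫ p : Factors m₁ m₂ K, rowsCost q.2 s' T' (1 / n) p.2 ∂gaussianLaw q s' =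
          ∫ x, rowsCost q.2 s' T' (1 / n) x ∂gaussianRows q.2 s' := by
        rw [gaussianLaw, integral_fun_snd (f := rowsCost q.2 s' T' (1 / n))]
        simp
      rw [← h4, ← h5]
      refine h2.trans ?_
      rw [integral_const]
      simp only [probReal_univ, one_smul]
      congr 1
    have h2 := hsum m₁ q.1 hq₁ hz₁
    have h3 := hsum m₂ q.2 hq₂ hz₂
    -- There are `n * K` entries, each charged `1 / (2 * n)` for the window width: `K / 2` in all,
    -- which dictates the choice `η = 1 / n`.
    have h4 : (m₁ : ℝ) * (K * (1 / (2 * n)) + r * ((Real.log (T / s) + 1) / 2)) +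
        m₂ * (K * (1 / (2 * n)) + r * ((Real.log (T / s) + 1) / 2)) =
        K * (1 / 2) + r * (n * (Real.log (T / s) + 1) / 2) := by
      rw [← add_mul, ← hn]
      field_simp
    rw [h1, hc]
    linarith
  -- On active columns all of `s`, `u ^ 2`, `v ^ 2` are at most `T`, giving `3 * s * T`; on null
  -- columns the centre vanishes and `b ^ 2` remains.
  obtain ⟨hR, hRle⟩ := h.integral_risk_sub_le hm₁ hm₂ q hs' (δ := 3 * s * T + b ^ 2)
    (fun i j k => by
      by_cases hk : (k : ℕ) < r
      · simp only [s', hk, if_true]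
        have h1 := mul_le_mul_of_nonneg_left (hq₁ i k) hs.le
        have h2 := mul_le_mul_of_nonneg_left (hq₂ j k) hs.le
        have h3 := mul_le_mul_of_nonneg_left hsT hs.le
        nlinarith [sq_nonneg b]
      · simp only [s', hk, if_false, hz₁ i k (not_lt.1 hk), hz₂ j k (not_lt.1 hk)]
        nlinarith [mul_pos hs hT]) hτ
  have hD' : β * ∫ p : Factors m₁ m₂ K, (risk P p.toMatrix - risk P p₀.toMatrix) ∂gaussianLaw q s' +
      ∫ p, F p ∂gaussianLaw q s' ≤ D := by
    have := mul_le_mul_of_nonneg_left hRle hβ.le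
    linarith
  have hκ0 := integral_nonneg_of_withDensity_le hFm hF hle
  have hkl := klDiv_le_of_withDensity_le hFm hF hle
  refine ⟨(iInf₂_le _ (gaussianLaw_mem_meanField q s')).trans
    (h.klDiv_gibbs_le hβ hR hFm hF hle le_rfl hD'), ?_, ?_⟩
  · intro lam f ε hlam _ _ _
    exact h.slowBound_le hβ (gaussianLaw_mem_meanField q s') hR hκ0 hkl hD' hlam
  · intro lam g ε hlam hg _ _
    exact h.fastBound_le (gaussianLaw_mem_meanField q s') hR hκ0 hβ hkl hD' hlam hg

end Trial

/-! ### Comparison of the cost with the complexity term. -/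

/-- This is the only consequence of the upper bound on `b` that the cost estimates use; `2 / 3` is a
lower bound for `log 2`. -/
theorem mul_le_of_scale_le {n m K b β : ℝ} (hK : 1 ≤ K) (hβ : 0 < β) (hb : 0 < b) (hn : 2 ≤ n)
    (hnm : n ≤ 2 * m) (h : b ≤ 1 / (2 * β * m * Real.log (2 * K * m))) : β * b * n ≤ 3 / 2 := by
  have hm : 1 ≤ m := by linarith
  have hlog : 2 / 3 ≤ Real.log (2 * K * m) := by
    have h1 : Real.log 2 ≤ Real.log (2 * K * m) := Real.log_le_log (by norm_num) (by nlinarith)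
    have := Real.log_two_gt_d9
    linarith
  rw [le_div_iff₀ (by positivity)] at h
  have h2 : β * b * n * (2 / 3) ≤ b * (2 * β * m * Real.log (2 * K * m)) := by
    calc β * b * n * (2 / 3) ≤ β * b * (2 * m) * Real.log (2 * K * m) := by gcongr
      _ = _ := by ring
  linarith

/-- The total cost of the trial law centred at a rank factorization. -/
theorem trial_cost_le_of_one_le {n K r a b β D₀ Λ : ℝ} (hn : 2 ≤ n) (hK : 1 ≤ K) (hKn : K ≤ n)
    (hr : 1 ≤ r) (ha : 0 < a) (hb : 0 < b) (hβ : 0 < β) (hD₀ : 2 ≤ D₀)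
    (hbn : β * b * n ≤ 3 / 2) (hβK : 1 ≤ β * K) :
    b ≤ D₀ * n ^ 4 ∧
    β * (4 * K ^ 2 * (3 * min (D₀ * n ^ 4) (n / (β * K ^ 2 * (D₀ * n ^ 4))) * (D₀ * n ^ 4) +
        b ^ 2) + 2 * 0) +
      (K * (Λ + Real.log n + 1 / 2) + r * (a * Real.log (D₀ * n ^ 4 / b) +
        n * (Real.log (D₀ * n ^ 4 / min (D₀ * n ^ 4) (n / (β * K ^ 2 * (D₀ * n ^ 4)))) + 1) / 2)) ≤
      (70 + 4 * |Λ| + a * (4 * Real.log (8 * D₀) + 4) + 2 * Real.log (512 * D₀ ^ 2)) *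
        (r * n * Real.posLog (β * n * K / b) + 1 / β) := by
  have hn0 : 0 < n := by linarith
  have hK0 : 0 < K := by linarith
  set T := D₀ * n ^ 4 with hT
  have hT0 : 0 < T := by positivity
  -- The second argument makes the risk term `β K² s T` at most `n`; the first ensures `s ≤ T`.
  set s := min T (n / (β * K ^ 2 * T)) with hs
  have hs0 : 0 < s := lt_min hT0 (by positivity)
  set A := β * n * K / b with hA
  have hA0 : 0 < A := by positivity
  have hb2 : b ≤ 3 / 2 := by
    have : b * 1 ≤ b * (β * n) := by gcongr; nlinarith
    linarith
  have hnb : n / b ≤ A := by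
    rw [hA]; gcongr; nlinarith
  have hnA : n ≤ 3 / 2 * A := by
    rw [div_le_iff₀ hb] at hnb
    nlinarith
  have hA1 : 4 / 3 ≤ A := by linarith
  have hβKA : β * K ≤ 2 * A := by
    have : β * K * n = A * b := by rw [hA]; field_simp
    nlinarith [mul_pos hβ hK0]
  have hpl : Real.posLog A = Real.log A := Real.posLog_eq_log (by
    rw [abs_of_pos hA0]; linarith)
  rw [hpl]
  set L := Real.log A with hL
  -- A positive lower bound on `L` lets additive constants be absorbed, through `1 ≤ 4 * L`.
  have hL4 : 1 / 4 ≤ L := by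
    have h1 := Real.one_sub_inv_le_log_of_pos hA0
    have h2 : A⁻¹ ≤ 3 / 4 := by
      rw [inv_le_comm₀ hA0 (by norm_num)]; linarith
    linarith
  have hbT : b ≤ T := by
    have : 2 * 1 ≤ D₀ * n ^ 4 := by
      gcongr
      exact one_le_pow₀ (by linarith)
    linarith
  refine ⟨hbT, ?_⟩
  have hlogn : Real.log n ≤ 1 + L := by
    have h1 : Real.log n ≤ Real.log (2 * A) := Real.log_le_log hn0 (by linarith)
    rw [Real.log_mul (by norm_num) hA0.ne'] at h1
    have := Real.log_two_lt_d9
    linarith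
  have hlogTb : Real.log (T / b) ≤ Real.log (8 * D₀) + 4 * L := by
    have h1 : T / b ≤ 8 * D₀ * A ^ 4 := by
      calc T / b = D₀ * n ^ 3 * (n / b) := by rw [hT]; ring
        _ ≤ D₀ * (2 * A) ^ 3 * A := by gcongr; linarith
        _ = _ := by ring
    calc _ ≤ Real.log (8 * D₀ * A ^ 4) := Real.log_le_log (by positivity) h1
      _ = _ := by rw [Real.log_mul (by positivity) (by positivity), Real.log_pow]; norm_num; rfl
  have hlogTs : Real.log (T / s) ≤ Real.log (512 * D₀ ^ 2) + 9 * L := by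
    -- Each of `β * K`, `K` and `n` is at most `2 * A`; nine such factors produce `512 = 2 ^ 9` and
    -- `A ^ 9`.
    have h1 : T / s ≤ 512 * D₀ ^ 2 * A ^ 9 := by
      rw [div_le_iff₀ hs0, hs, mul_min_of_nonneg _ _ (by positivity)]
      refine le_min ?_ ?_
      · have h2 : (1 : ℝ) * 1 ≤ 512 * D₀ ^ 2 * A ^ 9 := by
          refine mul_le_mul (by nlinarith) (one_le_pow₀ (by linarith)) zero_le_one (by positivity)
        nlinarith
      · rw [← mul_div_assoc, le_div_iff₀ (by positivity)]
        calc T * (β * K ^ 2 * T) = D₀ ^ 2 * (β * K) * K * n ^ 7 * n := by rw [hT]; ring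
          _ ≤ D₀ ^ 2 * (2 * A) * (2 * A) * (2 * A) ^ 7 * n := by gcongr <;> linarith
          _ = _ := by ring
    calc _ ≤ Real.log (512 * D₀ ^ 2 * A ^ 9) := Real.log_le_log (by positivity) h1
      _ = _ := by rw [Real.log_mul (by positivity) (by positivity), Real.log_pow]; norm_num; rfl
  have hl1 : 0 ≤ Real.log (8 * D₀) := Real.log_nonneg (by linarith)
  have hl2 : 0 ≤ Real.log (512 * D₀ ^ 2) := Real.log_nonneg (by nlinarith)
  have hnr : n ≤ r * n := by nlinarith
  have hR0 : 0 ≤ r * n := by positivity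
  set l₁ := Real.log (8 * D₀)
  set l₂ := Real.log (512 * D₀ ^ 2)
  have hone : 1 ≤ 4 * L := by linarith
  have hL0 : 0 ≤ L := by linarith
  have B1 : 12 * (β * K ^ 2 * s * T) ≤ 48 * (r * n * L) := by
    have h1 : β * K ^ 2 * s * T ≤ n := by
      have h2 : s ≤ n / (β * K ^ 2 * T) := min_le_right _ _
      rw [le_div_iff₀ (by positivity)] at h2
      linarith
    have h3 : r * n * 1 ≤ r * n * (4 * L) := by gcongr
    linarith
  have B2 : 4 * (β * K ^ 2 * b ^ 2) ≤ 9 * (1 / β) := by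
    have h1 : (β * b * K) ^ 2 ≤ (3 / 2) ^ 2 := by
      gcongr
      exact le_trans (by gcongr) hbn
    have h2 : β * K ^ 2 * b ^ 2 = (β * b * K) ^ 2 * (1 / β) := by field_simp
    rw [h2]
    have : (β * b * K) ^ 2 * (1 / β) ≤ (3 / 2) ^ 2 * (1 / β) := by gcongr
    linarith
  have B3 : K * (Λ + Real.log n + 1 / 2) ≤ (4 * |Λ| + 7) * (r * n * L) := by
    calc K * (Λ + Real.log n + 1 / 2) ≤ K * (|Λ| * (4 * L) + 7 * L) := by
          refine mul_le_mul_of_nonneg_left ?_ hK0.le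
          have h1 : |Λ| * 1 ≤ |Λ| * (4 * L) := by gcongr
          linarith [le_abs_self Λ]
      _ ≤ (r * n) * (|Λ| * (4 * L) + 7 * L) := by gcongr; linarith
      _ = _ := by ring
  have B4 : r * (a * Real.log (T / b)) ≤ a * (4 * l₁ + 4) * (r * n * L) := by
    calc r * (a * Real.log (T / b)) ≤ r * (a * (l₁ * (4 * L) + 4 * L)) := by
          gcongr
          have h1 : l₁ * 1 ≤ l₁ * (4 * L) := by gcongr
          linarith
      _ = r * 1 * (a * (4 * l₁ + 4)) * L := by ring
      _ ≤ r * n * (a * (4 * l₁ + 4)) * L := by gcongr; linarith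
      _ = _ := by ring
  have B5 : r * (n * (Real.log (T / s) + 1) / 2) ≤ (2 * l₂ + 13 / 2) * (r * n * L) := by
    calc r * (n * (Real.log (T / s) + 1) / 2) ≤ r * (n * (l₂ * (4 * L) + 13 * L) / 2) := by
          have h1 : l₂ * 1 ≤ l₂ * (4 * L) := by gcongr
          have h2 : Real.log (T / s) + 1 ≤ l₂ * (4 * L) + 13 * L := by linarith
          gcongr
      _ = _ := by ring
  have hX : 0 ≤ r * n * L := by positivity
  have hY : 0 ≤ 1 / β := by positivity
  set X := r * n * L
  set Y := 1 / β
  have hW : 0 ≤ 4 * |Λ| + a * (4 * l₁ + 4) + 2 * l₂ := by positivity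
  have hWY := mul_nonneg hW hY
  linarith

/-- The total cost of the trial law centred at zero. -/
theorem trial_cost_le_of_le_one {n K r b β C Λ : ℝ} (hn : 2 ≤ n) (hK : 1 ≤ K) (hKn : K ≤ n)
    (hr : 1 ≤ r) (hb : 0 < b) (hβ : 0 < β) (hbn : β * b * n ≤ 3 / 2) (hβK : β * K ≤ 1) :
    β * (4 * K ^ 2 * (3 * b * b + b ^ 2) + 2 * (K * C ^ 2) ^ 2) +
      K * (Λ + Real.log n + 1 / 2) ≤
      (46 + 2 * C ^ 4 + |Λ|) * (r * n * Real.posLog (β * n * K / b) + 1 / β) := by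
  have hn0 : 0 < n := by linarith
  have hK0 : 0 < K := by linarith
  set A := β * n * K / b with hA
  have hA0 : 0 < A := by positivity
  set L := Real.posLog A with hL
  have hL0 : 0 ≤ L := Real.posLog_nonneg
  have hKY : K ≤ 1 / β := by rw [le_div_iff₀ hβ]; linarith
  have hY0 : 0 < 1 / β := by positivity
  have B1 : 16 * (β * K ^ 2 * b ^ 2) ≤ 36 * (1 / β) := by
    have h1 : (β * b * K) ^ 2 ≤ (3 / 2) ^ 2 := by
      gcongr
      exact le_trans (by gcongr) hbn
    have h2 : β * K ^ 2 * b ^ 2 = (β * b * K) ^ 2 * (1 / β) := by field_simp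
    rw [h2]
    have : (β * b * K) ^ 2 * (1 / β) ≤ (3 / 2) ^ 2 * (1 / β) := by gcongr
    linarith
  have B2 : 2 * (β * K ^ 2 * C ^ 4) ≤ 2 * C ^ 4 * (1 / β) := by
    have h1 : β * K ^ 2 = (β * K) ^ 2 * (1 / β) := by field_simp
    have h2 : (β * K) ^ 2 ≤ 1 := pow_le_one₀ (by positivity) hβK
    have h3 : (β * K) ^ 2 * (1 / β) * C ^ 4 ≤ 1 * (1 / β) * C ^ 4 := by gcongr
    rw [h1]
    linarith
  have B3 : K * (Λ + 1 / 2) ≤ (|Λ| + 1 / 2) * (1 / β) := by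
    calc K * (Λ + 1 / 2) ≤ K * (|Λ| + 1 / 2) := by gcongr; exact le_abs_self _
      _ ≤ 1 / β * (|Λ| + 1 / 2) := by gcongr
      _ = _ := by ring
  -- Here `A` may be small while `n` is large, so `log n` is not bounded by `L` alone. If `K log n`
  -- exceeds `1 / β`, however, `√n` is forced below a multiple of `A`.
  have B4 : K * Real.log n ≤ 8 * (1 / β) + 2 * (n * L) := by
    rcases le_or_gt (K * Real.log n) (1 / β) with h | h
    · have : 0 ≤ n * L := by positivity
      linarith
    · have hlog0 : 0 < Real.log n := Real.log_pos (by linarith)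
      -- With `w = n ^ (1/4)`, `log n ≤ 4 w`. Squaring `1 < β K log n` and multiplying by `w ^ 2`
      -- turns the right side into `16 β² n² K`, which is at most `24 * A` because `β b n ≤ 3 / 2`.
      set w := √(√n) with hw
      have hw0 : 0 < w := by positivity
      have hw2 : w ^ 2 = √n := Real.sq_sqrt (by positivity)
      have hw4 : w ^ 4 = n := by
        rw [show w ^ 4 = (w ^ 2) ^ 2 by ring, hw2, Real.sq_sqrt hn0.le]
      have hlogw : Real.log n = 4 * Real.log w := by
        rw [← hw4, Real.log_pow]; norm_num
      have hlogle : Real.log n ≤ 4 * w := by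
        have := Real.log_le_sub_one_of_pos hw0
        linarith
      have h1 : 1 < β * (K * Real.log n) := by
        rw [div_lt_iff₀ hβ] at h; linarith
      have h2 : 1 ≤ β ^ 2 * K * n * (16 * w ^ 2) := by
        calc (1 : ℝ) ≤ (β * (K * Real.log n)) ^ 2 := one_le_pow₀ h1.le
          _ = β ^ 2 * K * K * Real.log n ^ 2 := by ring
          _ ≤ β ^ 2 * K * n * (4 * w) ^ 2 := by gcongr
          _ = _ := by ring
      have h3 : w ^ 2 ≤ 24 * A := by
        have h4 : β ^ 2 * n ^ 2 * K ≤ 3 / 2 * A := by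
          rw [hA, ← mul_div_assoc, le_div_iff₀ hb]
          calc β ^ 2 * n ^ 2 * K * b = (β * b * n) * (β * n * K) := by ring
            _ ≤ 3 / 2 * (β * n * K) := by gcongr
        have h5 : w ^ 2 * 1 ≤ w ^ 2 * (β ^ 2 * K * n * (16 * w ^ 2)) := by gcongr
        have h6 : w ^ 2 * (β ^ 2 * K * n * (16 * w ^ 2)) = 16 * (β ^ 2 * n ^ 2 * K) := by
          rw [show w ^ 2 * (β ^ 2 * K * n * (16 * w ^ 2)) = 16 * (β ^ 2 * K * n * w ^ 4) by ring,
            hw4]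
          ring
        linarith
      have h7 : Real.log n ≤ 8 + 2 * L := by
        -- `24` is rounded up to `32 = 2 ^ 5`; as `log (w ^ 2)` is half of `log n`, the constant
        -- becomes `10 log 2 < 8`.
        have h8 : Real.log (w ^ 2) ≤ Real.log (32 * A) :=
          Real.log_le_log (by positivity) (by linarith)
        rw [Real.log_mul (by norm_num) hA0.ne', Real.log_pow,
          show (32 : ℝ) = 2 ^ 5 by norm_num, Real.log_pow] at h8
        have h9 := Real.log_two_lt_d9
        have h10 : Real.log A ≤ L := le_max_right _ _
        push_cast at h8
        linarith
      calc K * Real.log n ≤ K * (8 + 2 * L) := by gcongr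
        _ = 8 * K + 2 * (K * L) := by ring
        _ ≤ 8 * (1 / β) + 2 * (n * L) := by gcongr
  have hX : n * L ≤ r * n * L := by
    have : 1 * (n * L) ≤ r * (n * L) := by gcongr
    linarith
  have hX0 : 0 ≤ n * L := by positivity
  have hW : 0 ≤ (46 + 2 * C ^ 4 + |Λ| - 2) * (r * n * L) := by
    have : 0 ≤ C ^ 4 := by positivity
    exact mul_nonneg (by linarith [abs_nonneg Λ]) (by linarith)
  nlinarith

end MatrixCompletion

/-! ### Assembly of the two regimes. -/

theorem mainTheorem10 (a C : ℝ) (ha : 0 < a) (hC : 0 < C) :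
    ∃ 𝒞 : ℝ, 0 < 𝒞 ∧
      ∀ (m₁ m₂ K r : ℕ) (p₀ : MatrixCompletion.Factors m₁ m₂ K)
        (P : Measure ((Fin m₁ × Fin m₂) × ℝ)) (b β : ℝ),
        1 ≤ r → K ≤ m₁ + m₂ →
        p₀.toMatrix.rank = r →
        (∀ i k, |p₀.1 i k| ≤ C) → (∀ j k, |p₀.2 j k| ≤ C) →
        MatrixCompletion.IsObservationLaw p₀.toMatrix P →
        0 < β → 0 < b →
        b ≤ 1 / (2 * β * max (m₁ : ℝ) m₂ * Real.log (2 * K * max (m₁ : ℝ) m₂)) →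
        (⨅ ρ ∈ MatrixCompletion.meanField m₁ m₂ K,
            klDiv ρ (MatrixCompletion.gibbs P (MatrixCompletion.prior m₁ m₂ K a b) β))
          ≤ ENNReal.ofReal (𝒞 * MatrixCompletion.complexity m₁ m₂ K r b β) ∧
        (∀ lam f ε : ℝ, lam = 2 * β → 0 ≤ f → 0 < ε → ε < 1 →
          MatrixCompletion.slowBound P (MatrixCompletion.prior m₁ m₂ K a b) lam f ε
              (MatrixCompletion.meanField m₁ m₂ K)
            ≤ MatrixCompletion.slowBound P (MatrixCompletion.prior m₁ m₂ K a b) lam f ε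
                (MatrixCompletion.allLaws m₁ m₂ K)
              + ENNReal.ofReal (2 / lam * (𝒞 * MatrixCompletion.complexity m₁ m₂ K r b β))) ∧
        (∀ lam g ε : ℝ, lam + g = 2 * β → 0 < lam - g → 0 < ε → ε < 1 →
          MatrixCompletion.fastBound P (MatrixCompletion.prior m₁ m₂ K a b) lam g ε
              (MatrixCompletion.meanField m₁ m₂ K)
            ≤ MatrixCompletion.fastBound P (MatrixCompletion.prior m₁ m₂ K a b) lam g ε
                (MatrixCompletion.allLaws m₁ m₂ K)
              + ENNReal.ofReal (2 / (lam - g) *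
                  (𝒞 * MatrixCompletion.complexity m₁ m₂ K r b β))) := by
  open MatrixCompletion in
  set Λ := invGammaCost a
  -- The refactored entries are at most `m₁ * (K * C ^ 2) ≤ n ^ 2 * C ^ 2` in the second factor and
  -- `1` in the first, so `D₀ * n ^ 4` bounds all their squares.
  set D₀ := C ^ 4 + 2 with hD₀
  have hC4 : 0 ≤ C ^ 4 := by positivity
  have hD₀2 : 2 ≤ D₀ := by linarith
  set c₁ := 70 + 4 * |Λ| + a * (4 * Real.log (8 * D₀) + 4) + 2 * Real.log (512 * D₀ ^ 2)
  set c₂ := 46 + 2 * C ^ 4 + |Λ|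
  have hl1 : 0 ≤ Real.log (8 * D₀) := Real.log_nonneg (by linarith)
  have hl2 : 0 ≤ Real.log (512 * D₀ ^ 2) := Real.log_nonneg (by nlinarith)
  have hc₁ : 0 < c₁ := by positivity
  have hc₂ : 0 < c₂ := by positivity
  refine ⟨c₁ + c₂, by positivity, ?_⟩
  intro m₁ m₂ K r p₀ P b β hr hKm hrank hU hV hP hβ hb hbβ
  change VariationalBounds P (prior m₁ m₂ K a b) β ((c₁ + c₂) * complexity m₁ m₂ K r b β)
  have hrK : r ≤ K := by
    rw [← hrank]
    exact (Matrix.rank_mul_le_left _ _).trans (by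
      simpa using Matrix.rank_le_card_width (Matrix.of p₀.1))
  have hrm₁ : r ≤ m₁ := by simpa [hrank] using p₀.toMatrix.rank_le_card_height
  have hrm₂ : r ≤ m₂ := by simpa [hrank] using p₀.toMatrix.rank_le_card_width
  have hm₁ : (1 : ℝ) ≤ m₁ := by exact_mod_cast hr.trans hrm₁
  have hm₂ : (1 : ℝ) ≤ m₂ := by exact_mod_cast hr.trans hrm₂
  have hK : (1 : ℝ) ≤ K := by exact_mod_cast hr.trans hrK
  have hKn : (K : ℝ) ≤ m₁ + m₂ := by exact_mod_cast hKm
  have hr' : (1 : ℝ) ≤ r := by exact_mod_cast hr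
  have hn : (2 : ℝ) ≤ (m₁ : ℝ) + m₂ := by linarith
  have hbn := mul_le_of_scale_le hK hβ hb hn
    (by linarith [le_max_left (m₁ : ℝ) m₂, le_max_right (m₁ : ℝ) m₂]) hbβ
  have hM : ∀ i j, |p₀.toMatrix i j| ≤ K * C ^ 2 := by
    intro i j
    rw [Factors.toMatrix_apply]
    calc |∑ k, p₀.1 i k * p₀.2 j k| ≤ ∑ k, |p₀.1 i k * p₀.2 j k| :=
          Finset.abs_sum_le_sum_abs _ _
      _ ≤ ∑ _k : Fin K, C * C := by
          refine Finset.sum_le_sum fun k _ => ?_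
          rw [abs_mul]
          exact mul_le_mul (hU i k) (hV j k) (abs_nonneg _) hC.le
      _ = K * C ^ 2 := by simp [pow_two]
  have hcomp : 0 ≤ complexity m₁ m₂ K r b β := by
    unfold complexity
    have := Real.posLog_nonneg (x := β * ((m₁ : ℝ) + m₂) * K / b)
    positivity
  -- If `β * K ≥ 1`, centring at `M` exactly is affordable. Otherwise the squared error `(K * C ^ 2)
  -- ^ 2` of the zero matrix, times `β`, is at most `C ^ 4 / β`.
  rcases le_total 1 (β * K) with hβK | hβK
  · obtain ⟨q, hq1, hq2, hz1, hz2, hqM⟩ :=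
      exists_padded_rank_factorization (K := K) p₀.toMatrix hrank hrK (by positivity) hM
    obtain ⟨hbT, hcost⟩ := trial_cost_le_of_one_le (Λ := Λ) hn hK hKn hr' ha hb hβ hD₀2 hbn hβK
    set n : ℝ := (m₁ : ℝ) + m₂ with hn'
    have hn4 : 1 ≤ n ^ 4 := one_le_pow₀ (by linarith)
    refine hP.variationalBounds_of_trial (r := r) (τ := 0) ha hb hβ (hr.trans hrm₁)
      (hr.trans hrm₂) hrK q hbT (lt_min (by positivity) (by positivity)) (min_le_left _ _)
      (fun i k => ?_) (fun j k => ?_) hz1 hz2 (fun i j => by rw [hqM]; simp)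
      (hcost.trans ?_)
    · have h1 : q.1 i k ^ 2 ≤ 1 := (sq_le_one_iff_abs_le_one _).2 (hq1 i k)
      nlinarith
    · have h1 : |q.2 j k| ≤ n * (n * C ^ 2) := by
        refine (hq2 j k).trans ?_
        gcongr
        linarith
      rw [← sq_abs]
      calc |q.2 j k| ^ 2 ≤ (n * (n * C ^ 2)) ^ 2 := by gcongr
        _ = C ^ 4 * n ^ 4 := by ring
        _ ≤ D₀ * n ^ 4 := by gcongr; linarith
    · refine mul_le_mul_of_nonneg_right ?_ hcomp
      linarith
  · have hcost := trial_cost_le_of_le_one (C := C) (Λ := Λ) hn hK hKn hr' hb hβ hbn hβK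
    -- Taking `r := 0` declares every column null, so with `T = s = b` only the `K log n` part of
    -- the divergence survives.
    refine hP.variationalBounds_of_trial (r := 0) (τ := (K * C ^ 2) ^ 2) ha hb hβ (hr.trans hrm₁)
      (hr.trans hrm₂) (Nat.zero_le _) (fun _ _ => 0, fun _ _ => 0) le_rfl hb le_rfl
      (fun i k => by simpa using hb.le) (fun j k => by simpa using hb.le)
      (fun i k _ => rfl) (fun j k _ => rfl) (fun i j => ?_) ?_
    · rw [Factors.toMatrix_apply]
      simp only [mul_zero, Finset.sum_const_zero, zero_sub, neg_sq]
      rw [← sq_abs]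
      have := hM i j
      gcongr
    · refine le_trans (le_of_eq ?_) (hcost.trans (mul_le_mul_of_nonneg_right ?_ hcomp))
      · simp [Λ]
      · linarith
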